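/- **Conventions.** Let $R$ be a discrete valuation ring with residue field $k$ and normalized valuation $v\colon R\to\mathbb{Z}_{\ge 0}\cup\{\infty\}$. A symmetric bilinear space over $R$ is a finite-rank free $R$-module $M$ with a symmetric $R$-bilinear pairing $\beta\colon M\times M\to R$. For a ring $A$ and a homogeneous polynomial $f\in A[x_0,\dots,x_n]$ defining $H=H_f\subset\mathbb{P}^n_A$, let $H_{\mathrm{sing}}\subset\mathbb{P}^n_A$ be the closed subscheme defined by $f=\partial f/\partial x_0=\cdots=\partial f/\partial x_n=0$; its complement in $H$ is the locus where $H\to\operatorname{Spec}A$ is smooth of relative dimension $n-1$. "$H$ is smooth" means smooth of relative dimension $n-1$ everywhere, i.e. $H_{\mathrm{sing}}=\emptyset$. (So $f=0$ over a field does not define a smooth hypersurface.) For $n\ge 1$ let $F=\sum_{\mathbf i}a_{\mathbf i}x^{\mathbf i}$ be the generic quadratic form in $x_0,\dots,x_n$ over $\mathbb{Z}[\{a_{\mathbf i}\}]$, let $\mathcal{H}_{\mathrm{sing}}$ be the corresponding $H_{\mathrm{sing}}$ of $F$, and let $D\subset\operatorname{Spec}\mathbb{Z}[\{a_{\mathbf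 i}\}]$ be the image of $\mathcal{H}_{\mathrm{sing}}$. The ideal of polynomials vanishing on $D$ is principal; the discriminant $\Delta$ is a generator of it (unique up to sign), and $\Delta(f)\in R$ denotes its value at the coefficients of a quadratic form $f$ over $R$. **Proposition.** Let $R$ be a discrete valuation ring. (a) Each symmetric bilinear space over $R$ is an orthogonal direct sum of spaces of rank $1$ or $2$. (b) Every quadratic form $f(x_0,\dots,x_n)$ over $R$ is equivalent, by an invertible $R$-linear change of variables, to one of the form $$\sum_{i=1}^I (a_i x_i^2+b_i x_i y_i+c_i y_i^2)+\sum_{j=1}^J d_j z_j^2$$ with $2I+J=n+1$ and $a_i,b_i,c_i,d_j\in R$. (c) For $n\ge 1$ the discriminant $\Delta$ exists as above. Let $f\in R[x_0,\dots,x_n]$ be a quadratic form, and let $H_k\subset\mathbb{P}^n_k$ be the hypersurface defined by the reduction of $f$ to $k$. If $H_k$ is smooth, then $v(\Delta(f))=0$. Otherwise, $v(\Delta(f))\ge\dim\,(H_k)_{\mathrm{sing}}+1$. -/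

import Mathlib

open MvPolynomial

namespace QuadricDisc

noncomputable section

attribute [local instance] MvPolynomial.gradedAlgebra

/-- Projective `n`-space over a ring `A` (the underlying topological space of
`Proj A[x_0, …, x_n]` with its standard grading). -/
abbrev ProjSpace (A : Type*) [CommRing A] (n : ℕ) : Type _ :=
  ProjectiveSpectrum (homogeneousSubmodule (Fin (n + 1)) A)

/-- The structure morphism `ℙⁿ_A → Spec A` on points: a homogeneous prime of `A[x_0, …, x_n]`
is sent to its contraction to `A`. -/
def ProjSpace.toSpec {A : Type*} [CommRing A] {n : ℕ} (P : ProjSpace A n) : PrimeSpectrum A :=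
  ⟨P.asHomogeneousIdeal.toIdeal.comap (C : A →+* MvPolynomial (Fin (n + 1)) A),
    P.isPrime.comap _⟩

/-- The (underlying closed set of the) relative singular subscheme `H_sing` of the hypersurface
`H : f = 0` in `ℙⁿ_A`: the closed subset of `ℙⁿ_A` defined by
`f = ∂f/∂x_0 = ⋯ = ∂f/∂x_n = 0`. Its complement in `H` is the locus where `H → Spec A` is
smooth of relative dimension `n - 1`. -/
def singularLocus {A : Type*} [CommRing A] {n : ℕ} (f : MvPolynomial (Fin (n + 1)) A) :
    Set (ProjSpace A n) :=
  ProjectiveSpectrum.zeroLocus (homogeneousSubmodule (Fin (n + 1)) A)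
    (insert f (Set.range fun i => pderiv i f))

/-- `H : f = 0` is a smooth hypersurface over `A`, i.e. `H → Spec A` is smooth of relative
dimension `n - 1` at every point, i.e. `H_sing` is empty. (In particular `f = 0`, for which `H`
is all of `ℙⁿ`, does not define a smooth hypersurface over a field.) -/
def IsSmoothHypersurface {A : Type*} [CommRing A] {n : ℕ} (f : MvPolynomial (Fin (n + 1)) A) :
    Prop :=
  singularLocus f = ∅

/-- Exponent vectors of the monomials of degree `d` in `x_0, …, x_n`. -/
abbrev Expo (n d : ℕ) : Type :=
  {s : Fin (n + 1) →₀ ℕ // s ∈ (Finset.univ : Finset (Fin (n + 1))).finsuppAntidiag d}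

/-- The ring `ℤ[{a_s}]` in the coefficients of the generic form of degree `d`. -/
abbrev CoeffRing (n d : ℕ) : Type := MvPolynomial (Expo n d) ℤ

/-- The generic form `F = ∑ a_s x^s` of degree `d` in `x_0, …, x_n`. -/
def genericForm (n d : ℕ) : MvPolynomial (Fin (n + 1)) (CoeffRing n d) :=
  ∑ s : Expo n d, monomial s.1 (X s : CoeffRing n d)

/-- The locus `D ⊆ 𝔸^N = Spec ℤ[{a_s}]` of singular hypersurfaces: the image of the relative
singular subscheme of the universal hypersurface under the projection to `𝔸^N`. -/
def discriminantLocus (n d : ℕ) : Set (PrimeSpectrum (CoeffRing n d)) :=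
  ProjSpace.toSpec '' singularLocus (genericForm n d)

/-- `Δ` is a discriminant polynomial for forms of degree `d` in `x_0, …, x_n`: it generates the
ideal of the reduced closed subscheme `D` of `𝔸^N`. This determines `Δ` up to sign. -/
def IsDiscriminant (n d : ℕ) (Δ : CoeffRing n d) : Prop :=
  PrimeSpectrum.vanishingIdeal (discriminantLocus n d) = Ideal.span {Δ}

/-- The value `Δ(f)`: the coefficients of `f` are substituted for the indeterminates. -/
def evalAtForm {R : Type*} [CommRing R] {n d : ℕ} (Δ : CoeffRing n d)
    (f : MvPolynomial (Fin (n + 1)) R) : R :=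
  aeval (fun s : Expo n d => coeff s.1 f) Δ

/-- Two polynomials are equivalent if an invertible linear change of variables over `R` takes
one to the other. -/
def FormEquiv {R : Type*} [CommRing R] {σ : Type*} [Fintype σ] [DecidableEq σ]
    (f g : MvPolynomial σ R) : Prop :=
  ∃ A : Matrix.GeneralLinearGroup σ R,
    bind₁ (fun i => ∑ j, C ((A : Matrix σ σ R) i j) * (X j : MvPolynomial σ R)) f = g

/-- The form `∑ (a_i x_i² + b_i x_i y_i + c_i y_i²) + ∑ d_j z_j²`; the variables `x_i`, `y_i`,
`z_j` are indexed by the three summands of `Fin I ⊕ Fin I ⊕ Fin J`. -/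
def blockForm {R : Type*} [CommRing R] {I J : ℕ} (a b c : Fin I → R) (d : Fin J → R) :
    MvPolynomial (Fin I ⊕ Fin I ⊕ Fin J) R :=
  (∑ i, (C (a i) * X (Sum.inl i) ^ 2
      + C (b i) * X (Sum.inl i) * X (Sum.inr (Sum.inl i))
      + C (c i) * X (Sum.inr (Sum.inl i)) ^ 2))
    + ∑ j, C (d j) * X (Sum.inr (Sum.inr j)) ^ 2

/-- The symmetric bilinear space `(M, β)` is an orthogonal direct sum of (automatically free)
submodules of rank `1` or `2`. -/
def IsOrthogonalSumOfRankOneOrTwo {R M : Type*} [CommRing R] [AddCommGroup M] [Module R M]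
    (β : LinearMap.BilinForm R M) : Prop :=
  ∃ (m : ℕ) (N : Fin m → Submodule R M),
    DirectSum.IsInternal N ∧
    (∀ i, Module.Free R (N i) ∧ (Module.finrank R (N i) = 1 ∨ Module.finrank R (N i) = 2)) ∧
    ∀ i j, i ≠ j → ∀ x ∈ N i, ∀ y ∈ N j, β x y = 0

end

end QuadricDisc

/-! Among the values of a symmetric form over a discrete valuation ring, some β(x, y) has minimal
valuation and therefore divides all the others. If a diagonal value β(x, x) can be chosen, the line
of x splits off; otherwise the Gram determinant of x, y is a unit times β(x, y)², and their plane
splits off. Induction on the rank gives (a) (`exists_isBlockBasis_aux`). Applied to the polar form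
of f it gives (b): orthogonality of distinct blocks says that the coefficients of mixed monomials
vanish, in any characteristic. Rank-one blocks are merged in pairs, so that J ≤ 1.

For the existence of Δ, the ideal of D is prime because one singular quadric over a domain
specializes to all singular quadrics over fields. It contains the nonzero Hessian determinant, but
no nonzero polynomial free of the coefficient of x_0². As an ideal of polynomials in that one
coefficient over a factorial ring, it is principal.

Δ itself is never computed; its value is bounded from two sides. The Hessian determinant, halved
when n + 1 is odd, lies in the ideal, so Δ(f) divides a unit times the product of the block
discriminants 4ac - b² and d; these are units when H_k is smooth. Conversely, each generic block
discriminant is prime and its vanishing makes the form singular, so the product divides Δ(f)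
(`prod_blockDisc_dvd`).

It remains to bound the dimension of the affine cone over the singular locus by the valuation of
that product (`ringKrullDim_singular_le`). Each block contributes at most as many coordinates as the
valuation of its discriminant; a lone z with unit coefficient is integral over the others by the
equation f = 0. Passing from the cone to projective space accounts for the + 1. -/

open MvPolynomial

namespace QuadricDisc

noncomputable section

attribute [local instance] MvPolynomial.gradedAlgebra

/-! ### Quadratic forms as matrices, and their singular vectors -/

section QuadPoly

variable {S T : Type*} [CommRing S] [CommRing T] {σ τ : Type*} [Fintype σ] [Fintype τ]

/-- The quadratic form `∑ c_ij x_i x_j` attached to a square matrix. -/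
def quadPoly (c : Matrix σ σ S) : MvPolynomial σ S := ∑ i, ∑ j, C (c i j) * X i * X j

lemma quadPoly_add (c d : Matrix σ σ S) : quadPoly (c + d) = quadPoly c + quadPoly d := by
  simp [quadPoly, add_mul, Finset.sum_add_distrib]

lemma quadPoly_sum {ι : Type*} (s : Finset ι) (c : ι → Matrix σ σ S) :
    quadPoly (∑ i ∈ s, c i) = ∑ i ∈ s, quadPoly (c i) := by
  classical
  induction s using Finset.induction_on with
  | empty => simp [quadPoly]
  | insert a s ha ih => rw [Finset.sum_insert ha, Finset.sum_insert ha, quadPoly_add, ih]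

lemma quadPoly_single [DecidableEq σ] (i j : σ) (r : S) :
    quadPoly (Matrix.single i j r) = C r * X i * X j := by
  rw [quadPoly, Finset.sum_eq_single i, Finset.sum_eq_single j] <;>
    simp +contextual [Matrix.single, eq_comm]

lemma isHomogeneous_quadPoly (c : Matrix σ σ S) : (quadPoly c).IsHomogeneous 2 := by
  refine IsHomogeneous.sum _ _ _ fun i _ => IsHomogeneous.sum _ _ _ fun j _ => ?_
  simpa using ((isHomogeneous_C σ (c i j)).mul (isHomogeneous_X S i)).mul (isHomogeneous_X S j)

lemma exists_eq_quadPoly {f : MvPolynomial σ S} (hf : f.IsHomogeneous 2) :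
    ∃ c : Matrix σ σ S, f = quadPoly c := by
  classical
  have h : ∀ s ∈ f.support, ∃ c : Matrix σ σ S, monomial s (coeff s f) = quadPoly c := by
    intro s hs
    have h2 : s.toMultiset.card = 2 := by
      rw [Finsupp.card_toMultiset]
      have := hf (mem_support_iff.mp hs)
      rwa [Finsupp.weight_apply, Finsupp.sum_congr (g2 := fun _ => id) (by simp)] at this
    obtain ⟨i, j, hij⟩ := Multiset.card_eq_two.mp h2
    have hs' : s = Finsupp.single i 1 + Finsupp.single j 1 := by
      rw [← Finsupp.toMultiset_toFinsupp s, hij, Multiset.insert_eq_cons, ← Multiset.singleton_add,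
        map_add, Multiset.toFinsupp_singleton, Multiset.toFinsupp_singleton]
    refine ⟨Matrix.single i j (coeff s f), ?_⟩
    rw [quadPoly_single, C_mul_X_eq_monomial, X, monomial_mul, mul_one, ← hs']
  choose! c hc using h
  refine ⟨∑ s ∈ f.support, c s, ?_⟩
  rw [quadPoly_sum, ← Finset.sum_congr rfl hc]
  exact f.as_sum

lemma map_quadPoly (ψ : S →+* T) (c : Matrix σ σ S) :
    map ψ (quadPoly c) = quadPoly (c.map ψ) := by
  simp [quadPoly]

lemma eval_quadPoly (c : Matrix σ σ S) (x : σ → S) :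
    eval x (quadPoly c) = x ⬝ᵥ c.mulVec x := by
  simp only [quadPoly, map_sum, map_mul, eval_C, eval_X, dotProduct, Matrix.mulVec,
    Finset.mul_sum]
  exact Finset.sum_congr rfl fun i _ => Finset.sum_congr rfl fun j _ => by ring

lemma pderiv_quadPoly (c : Matrix σ σ S) (k : σ) :
    pderiv k (quadPoly c) = ∑ j, C ((c + c.transpose) k j) * X j := by
  classical
  simp only [quadPoly, map_sum, Derivation.leibniz, pderiv_C, pderiv_X, smul_eq_mul,
    Pi.single_apply, Matrix.add_apply, Matrix.transpose_apply, C_add, add_mul, mul_zero, add_zero,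
    Finset.sum_add_distrib, mul_ite, mul_one]
  rw [Finset.sum_comm, add_comm]
  congr 1
  · rw [Finset.sum_comm]
    simp [mul_comm]
  · simp [mul_comm]

lemma eval_pderiv_quadPoly (c : Matrix σ σ S) (k : σ) (x : σ → S) :
    eval x (pderiv k (quadPoly c)) = (c + c.transpose).mulVec x k := by
  simp [pderiv_quadPoly, Matrix.mulVec, dotProduct]

/-- The linear change of variables `x_i ↦ ∑ j, A_ij x_j`. -/
def subst (A : Matrix σ τ S) : MvPolynomial σ S →ₐ[S] MvPolynomial τ S :=
  bind₁ fun i => ∑ j, C (A i j) * X j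

lemma subst_X (A : Matrix σ τ S) (i : σ) : subst A (X i) = ∑ j, C (A i j) * X j := by
  simp [subst]

lemma subst_C (A : Matrix σ τ S) (r : S) : subst A (C r) = C r := by
  simp [subst]

lemma eval_subst (A : Matrix σ τ S) (f : MvPolynomial σ S) (x : τ → S) :
    eval x (subst A f) = eval (A.mulVec x) f := by
  have : (eval x).comp (subst A).toRingHom = eval (A.mulVec x) := by
    apply ringHom_ext <;> simp [subst, Matrix.mulVec, dotProduct]
  exact congrArg (fun g => g f) this

lemma map_subst (ψ : S →+* T) (A : Matrix σ τ S) (f : MvPolynomial σ S) :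
    map ψ (subst A f) = subst (A.map ψ) (map ψ f) := by
  simp [subst, map_bind₁]

lemma subst_subst {υ : Type*} [Fintype υ] (A : Matrix σ τ S) (B : Matrix τ υ S)
    (f : MvPolynomial σ S) : subst B (subst A f) = subst (A * B) f := by
  have : (subst B).comp (subst A) = subst (A * B) := by
    apply algHom_ext
    intro i
    simp only [AlgHom.comp_apply, subst_X, map_sum, map_mul, Finset.mul_sum, Matrix.mul_apply,
      Finset.sum_mul, subst_C]
    rw [Finset.sum_comm]
    simp only [mul_assoc]
  exact congrArg (fun g => g f) this

lemma subst_one [DecidableEq σ] (f : MvPolynomial σ S) : subst (1 : Matrix σ σ S) f = f := by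
  have : subst (1 : Matrix σ σ S) = AlgHom.id S _ := by
    apply algHom_ext
    intro i
    simp [subst_X, Matrix.one_apply, apply_ite (C (R := S) (σ := σ)), ite_mul]
  exact congrArg (fun g => g f) this

lemma quadPoly_eq_dotProduct (c : Matrix σ σ S) :
    quadPoly c = (X : σ → MvPolynomial σ S) ⬝ᵥ (c.map C).mulVec X := by
  simp only [quadPoly, dotProduct, Matrix.mulVec, Finset.mul_sum, Matrix.map_apply]
  exact Finset.sum_congr rfl fun i _ => Finset.sum_congr rfl fun j _ => by ring

lemma subst_quadPoly (A : Matrix σ τ S) (c : Matrix σ σ S) :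
    subst A (quadPoly c) = quadPoly (A.transpose * c * A) := by
  have hs : subst A (quadPoly c) =
      (A.map C).mulVec X ⬝ᵥ (c.map C).mulVec ((A.map C).mulVec (X : τ → MvPolynomial τ S)) := by
    rw [quadPoly_eq_dotProduct]
    simp [dotProduct, Matrix.mulVec, subst_X]
  rw [hs, quadPoly_eq_dotProduct, Matrix.map_mul, Matrix.map_mul, ← Matrix.mulVec_mulVec, ← Matrix.mulVec_mulVec,
    Matrix.transpose_map, Matrix.dotProduct_mulVec _ (A.map C).transpose, Matrix.vecMul_transpose]

lemma isHomogeneous_subst (A : Matrix σ τ S) {f : MvPolynomial σ S} (hf : f.IsHomogeneous 2) :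
    (subst A f).IsHomogeneous 2 := by
  obtain ⟨c, rfl⟩ := exists_eq_quadPoly hf
  rw [subst_quadPoly]
  exact isHomogeneous_quadPoly _

lemma eval_add_quadPoly (c : Matrix σ σ S) (x y : σ → S) :
    eval (x + y) (quadPoly c) = eval x (quadPoly c) + eval y (quadPoly c) +
      y ⬝ᵥ (c + c.transpose).mulVec x := by
  simp only [eval_quadPoly, Matrix.mulVec_add, Matrix.add_mulVec, add_dotProduct, dotProduct_add]
  have : y ⬝ᵥ c.transpose.mulVec x = x ⬝ᵥ c.mulVec y := by
    rw [Matrix.mulVec_transpose, dotProduct_comm, ← Matrix.dotProduct_mulVec]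
  rw [this]; ring

/-- The Hessian matrix of a quadratic form is determined by the form. -/
lemma add_transpose_eq_of_quadPoly_eq {c d : Matrix σ σ S} (h : quadPoly c = quadPoly d) :
    c + c.transpose = d + d.transpose := by
  classical
  ext i j
  have := congrArg (fun f => eval (Pi.single j 1) (pderiv i f)) h
  simpa [eval_pderiv_quadPoly, Matrix.mulVec_single] using this

/-- `x` is a common zero of `f` and of its partial derivatives. -/
def IsSingularAt (f : MvPolynomial σ S) (x : σ → S) : Prop :=
  eval x f = 0 ∧ ∀ i, eval x (pderiv i f) = 0

/-- By polarization f(y + r x) = f(y) + r² f(x) + r B(x, y), and both correction terms vanish. With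
the converse below, singular vectors are exactly the translations preserving f, a criterion that
passes through linear substitutions in every characteristic. -/
lemma IsSingularAt.eval_add {f : MvPolynomial σ S} (hf : f.IsHomogeneous 2) {x : σ → S}
    (h : IsSingularAt f x) (r : S) (y : σ → S) : eval (y + r • x) f = eval y f := by
  obtain ⟨c, rfl⟩ := exists_eq_quadPoly hf
  have h2 : (c + c.transpose).mulVec x = 0 := by
    ext i; simpa [eval_pderiv_quadPoly] using h.2 i
  have h1 := h.1
  rw [add_comm y, eval_add_quadPoly, Matrix.mulVec_smul, h2]
  rw [eval_quadPoly] at h1 ⊢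
  simp [Matrix.mulVec_smul, h1]

lemma isSingularAt_of_eval_add {f : MvPolynomial σ S} (hf : f.IsHomogeneous 2) {x : σ → S}
    (h : ∀ y, eval (y + x) f = eval y f) : IsSingularAt f x := by
  classical
  obtain ⟨c, rfl⟩ := exists_eq_quadPoly hf
  have h0 : eval x (quadPoly c) = 0 := by
    have := h 0
    rw [zero_add] at this
    rw [this, eval_quadPoly]; simp
  refine ⟨h0, fun i => ?_⟩
  have := h (Pi.single i 1)
  rw [add_comm, eval_add_quadPoly, h0, zero_add, add_eq_left] at this
  rw [eval_pderiv_quadPoly]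
  simpa using this

lemma IsSingularAt.map {f : MvPolynomial σ S} {x : σ → S} (h : IsSingularAt f x) (ψ : S →+* T) :
    IsSingularAt (MvPolynomial.map ψ f) (ψ ∘ x) := by
  refine ⟨?_, fun i => ?_⟩
  · rw [eval_map, ← eval₂_comp, h.1, map_zero]
  · rw [pderiv_map, eval_map, ← eval₂_comp, h.2, map_zero]

/-- A form pulled back along a linear map is singular along the kernel. -/
lemma IsSingularAt.subst {f : MvPolynomial σ S} (hf : f.IsHomogeneous 2) {A : Matrix σ τ S}
    {x : τ → S} {y : σ → S} (hy : IsSingularAt f y) {r : S} (h : A.mulVec x = r • y) :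
    IsSingularAt (subst A f) x := by
  refine isSingularAt_of_eval_add (isHomogeneous_subst A hf) fun z => ?_
  rw [eval_subst, eval_subst, Matrix.mulVec_add, h, hy.eval_add hf]

lemma isSingularAt_zero {f : MvPolynomial σ S} (hf : f.IsHomogeneous 2) :
    IsSingularAt f 0 :=
  isSingularAt_of_eval_add hf fun y => by rw [add_zero]

end QuadPoly

/-! ### Orthogonal splitting of symmetric bilinear spaces -/

section Splitting

open Module

/-- The block containing a given variable of `∑ (a_i x_i² + b_i x_i y_i + c_i y_i²) + ∑ d_j z_j²`. -/
def blockOf {ι κ : Type*} : ι ⊕ ι ⊕ κ → ι ⊕ κ := Sum.elim Sum.inl (Sum.elim Sum.inl Sum.inr)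

variable {R M : Type*} [CommRing R] [AddCommGroup M] [Module R M]

/-- A family on which `β` is nondegenerate splits off as an orthogonal summand. -/
lemma exists_basis_of_existsUnique_orthogonal {ι₀ ι' : Type*} [Fintype ι₀]
    (β : LinearMap.BilinForm R M) (v : ι₀ → M)
    (hv : ∀ u, ∃! c : ι₀ → R, ∀ i, β (v i) (u - ∑ j, c j • v j) = 0)
    {W : Submodule R M} (hW : ∀ w, w ∈ W ↔ ∀ i, β (v i) w = 0) (b : Basis ι' R W) :
    ∃ b' : Basis (ι₀ ⊕ ι') R M, (∀ i, b' (Sum.inl i) = v i) ∧ ∀ j, b' (Sum.inr j) = b j := by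
  -- Uniqueness of the projection of 0 is nondegeneracy on the span of `v`; existence of projections
  -- will give the spanning property.
  have hzero : ∀ c : ι₀ → R, (∀ i, β (v i) (∑ j, c j • v j) = 0) → c = 0 := by
    intro c hc
    obtain ⟨c₀, -, h₀⟩ := hv 0
    rw [h₀ c (fun i => by simpa using hc i), h₀ 0 (fun i => by simp)]
  have hli : LinearIndependent R (Sum.elim v fun j => (b j : M)) := by
    rw [linearIndependent_sum]
    refine ⟨?_, ?_, ?_⟩
    · rw [Fintype.linearIndependent_iff]
      intro c hc i
      have hc' : ∑ j, c j • v j = 0 := hc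
      exact congrFun (hzero c fun i => by rw [hc', map_zero]) i
    · exact b.linearIndependent.map' W.subtype W.ker_subtype
    · rw [Submodule.disjoint_def]
      intro x hx hx'
      have hxW : x ∈ W := by
        refine Submodule.span_le.mpr ?_ hx'
        rintro _ ⟨j, rfl⟩
        exact (b j).2
      obtain ⟨c, rfl⟩ := (Submodule.mem_span_range_iff_exists_fun R).mp hx
      have := hzero c ((hW _).mp hxW)
      simp [this]
  have hsp : ⊤ ≤ Submodule.span R (Set.range (Sum.elim v fun j => (b j : M))) := by
    intro u _
    obtain ⟨c, hc, -⟩ := hv u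
    have hu : u - ∑ j, c j • v j ∈ Submodule.span R (Set.range fun j => (b j : M)) := by
      have h1 : (⟨_, (hW _).mpr hc⟩ : W) ∈ Submodule.span R (Set.range b) := by simp
      have h2 := Submodule.mem_map_of_mem (f := W.subtype) h1
      rw [Submodule.map_span, ← Set.range_comp] at h2
      exact h2
    rw [Set.Sum.elim_range, Submodule.span_union, ← sub_add_cancel u (∑ j, c j • v j)]
    refine Submodule.add_mem _ (Submodule.mem_sup_right hu) (Submodule.mem_sup_left ?_)
    exact Submodule.sum_mem _ fun j _ =>
      Submodule.smul_mem _ _ (Submodule.subset_span ⟨j, rfl⟩)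
  exact ⟨Basis.mk hli hsp, fun i => by simp, fun j => by simp⟩

/-- `b` is a basis of `M` adapted to an orthogonal decomposition into blocks of rank `2` and `1`. -/
def IsBlockBasis (β : LinearMap.BilinForm R M) {ι κ : Type*} (b : Basis (ι ⊕ ι ⊕ κ) R M) : Prop :=
  ∀ i j, blockOf i ≠ blockOf j → β (b i) (b j) = 0

lemma IsBlockBasis.snoc {β : LinearMap.BilinForm R M} (hβ : β.IsSymm) {x : M}
    {W : Submodule R M} {ι κ : Type*} {b : Basis (ι ⊕ ι ⊕ κ) R W}
    (hb : IsBlockBasis (β.restrict W) b) (hW : ∀ w ∈ W, β x w = 0)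
    {b' : Basis (Unit ⊕ (ι ⊕ ι ⊕ κ)) R M} (hx : ∀ i, b' (Sum.inl i) = x)
    (hb' : ∀ j, b' (Sum.inr j) = b j) :
    ∃ b'' : Basis (ι ⊕ ι ⊕ (Unit ⊕ κ)) R M, IsBlockBasis β b'' := by
  let e : Unit ⊕ (ι ⊕ ι ⊕ κ) ≃ ι ⊕ ι ⊕ (Unit ⊕ κ) :=
    { toFun := Sum.elim (fun u => .inr (.inr (.inl u)))
        (Sum.elim .inl (Sum.elim (fun i => .inr (.inl i)) fun k => .inr (.inr (.inr k))))
      invFun := Sum.elim (fun i => .inr (.inl i)) (Sum.elim (fun i => .inr (.inr (.inl i)))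
        (Sum.elim .inl fun k => .inr (.inr (.inr k))))
      left_inv := by rintro (_ | _ | _ | _) <;> rfl
      right_inv := by rintro (_ | _ | _ | _) <;> rfl }
  have hxb : ∀ j, β x (b j) = 0 := fun j => hW _ (b j).2
  have hbx : ∀ j, β (b j) x = 0 := fun j => (hβ.eq x (b j)).symm.trans (hxb j)
  have hb0 : ∀ i j, blockOf i ≠ blockOf j → β (b i) (b j) = 0 := fun i j h => hb i j h
  refine ⟨b'.reindex e, ?_⟩
  rintro (i | i | i | i) (j | j | j | j) h <;>
    simp only [Basis.reindex_apply, e, Equiv.coe_fn_symm_mk, Sum.elim_inl, Sum.elim_inr, hx, hb',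
      hxb, hbx] <;>
    first
    | (refine hb0 _ _ fun h1 => ?_; simp [blockOf] at h h1; done)
    | (refine hb0 _ _ fun h1 => h ?_; simpa [blockOf] using h1)
    | simp [blockOf] at h

lemma IsBlockBasis.snoc_pair {β : LinearMap.BilinForm R M} (hβ : β.IsSymm) {v : Unit ⊕ Unit → M}
    {W : Submodule R M} {ι κ : Type*} {b : Basis (ι ⊕ ι ⊕ κ) R W}
    (hb : IsBlockBasis (β.restrict W) b) (hW : ∀ i, ∀ w ∈ W, β (v i) w = 0)
    {b' : Basis ((Unit ⊕ Unit) ⊕ (ι ⊕ ι ⊕ κ)) R M} (hx : ∀ i, b' (Sum.inl i) = v i)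
    (hb' : ∀ j, b' (Sum.inr j) = b j) :
    ∃ b'' : Basis ((Unit ⊕ ι) ⊕ (Unit ⊕ ι) ⊕ κ) R M, IsBlockBasis β b'' := by
  let e : (Unit ⊕ Unit) ⊕ (ι ⊕ ι ⊕ κ) ≃ (Unit ⊕ ι) ⊕ (Unit ⊕ ι) ⊕ κ :=
    { toFun := Sum.elim (Sum.elim (fun u => .inl (.inl u)) (fun u => .inr (.inl (.inl u))))
        (Sum.elim (fun i => .inl (.inr i)) (Sum.elim (fun i => .inr (.inl (.inr i)))
          fun k => .inr (.inr k)))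
      invFun := Sum.elim (Sum.elim (fun u => .inl (.inl u)) fun i => .inr (.inl i))
        (Sum.elim (Sum.elim (fun u => .inl (.inr u)) fun i => .inr (.inr (.inl i)))
          fun k => .inr (.inr (.inr k)))
      left_inv := by rintro ((_ | _) | _ | _ | _) <;> rfl
      right_inv := by rintro ((_ | _) | (_ | _) | _) <;> rfl }
  have hxb : ∀ i j, β (v i) (b j) = 0 := fun i j => hW i _ (b j).2
  have hbx : ∀ j i, β (b j) (v i) = 0 := fun j i =>
    (hβ.eq (v i) (b j)).symm.trans (hxb i j)
  have hb0 : ∀ i j, blockOf i ≠ blockOf j → β (b i) (b j) = 0 := fun i j h => hb i j h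
  refine ⟨b'.reindex e, ?_⟩
  rintro ((i | i) | (i | i) | i) ((j | j) | (j | j) | j) h <;>
    simp only [Basis.reindex_apply, e, Equiv.coe_fn_symm_mk, Sum.elim_inl, Sum.elim_inr, hx, hb',
      hxb, hbx] <;>
    first
    | (refine hb0 _ _ fun h1 => ?_; simp [blockOf] at h h1; done)
    | (refine hb0 _ _ fun h1 => h ?_; simpa [blockOf] using h1)
    | simp [blockOf] at h

lemma IsBlockBasis.reindex {β : LinearMap.BilinForm R M} {ι κ ι' κ' : Type*}
    {b : Basis (ι ⊕ ι ⊕ κ) R M} (hb : IsBlockBasis β b) (e : ι ⊕ ι ⊕ κ ≃ ι' ⊕ ι' ⊕ κ')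
    (he : ∀ i j, blockOf i = blockOf j → blockOf (e i) = blockOf (e j)) :
    IsBlockBasis β (b.reindex e) := by
  intro i j hij
  rw [Basis.reindex_apply, Basis.reindex_apply]
  refine hb _ _ fun h => hij ?_
  simpa using he _ _ h

variable [IsDomain R] [IsDiscreteValuationRing R]

/-- Valuations lie in the well-ordered set `ℕ∞`, so a minimum is attained, and divisibility is
comparison of valuations. -/
lemma exists_dvd_bilinForm (β : LinearMap.BilinForm R M) :
    ∃ x y, ∀ u w, β x y ∣ β u w := by
  obtain ⟨p, hmem, hp⟩ := (wellFounded_lt (α := ℕ∞)).has_min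
    (Set.range fun p : M × M => IsDiscreteValuationRing.addVal R (β p.1 p.2)) ⟨_, (0, 0), rfl⟩
  obtain ⟨⟨⟨x, y⟩, rfl⟩, hp⟩ := And.intro hmem hp
  refine ⟨x, y, fun u w => ?_⟩
  rw [← IsDiscreteValuationRing.addVal_le_iff_dvd]
  exact not_lt.mp (hp _ ⟨(u, w), rfl⟩)

/-- Induction on the rank. A value dividing all the others makes the orthogonal projection onto the
chosen line or plane integral, so the line or plane splits off and its orthogonal complement has
smaller rank. The zero form is the base case, where any basis works. -/
theorem exists_isBlockBasis_aux (r : ℕ) : ∀ (M : Type*) [AddCommGroup M] [Module R M]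
    [Module.Free R M] [Module.Finite R M] (β : LinearMap.BilinForm R M), β.IsSymm →
    finrank R M = r → ∃ (ι κ : Type) (_ : Finite ι) (_ : Finite κ) (b : Basis (ι ⊕ ι ⊕ κ) R M),
      IsBlockBasis β b := by
  induction r using Nat.strong_induction_on with
  | _ r ih =>
  intro M _ _ _ _ β hβ hr
  by_cases h0 : β = 0
  · refine ⟨Empty, Fin (finrank R M), inferInstance, inferInstance,
      (finBasis R M).reindex ((Equiv.emptySum Empty _).trans (Equiv.emptySum Empty _)).symm, ?_⟩
    intro i j _
    simp [h0]
  obtain ⟨x, y, hxy⟩ := exists_dvd_bilinForm β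
  have hg : β x y ≠ 0 := by
    intro h
    apply h0
    ext u w
    simpa [h] using hxy u w
  have key : ∀ {ι₀ : Type} [Fintype ι₀] [Nonempty ι₀] (v : ι₀ → M),
      (∀ u, ∃! c : ι₀ → R, ∀ i, β (v i) (u - ∑ j, c j • v j) = 0) →
      ∃ W : Submodule R M, (∀ i, ∀ w ∈ W, β (v i) w = 0) ∧
      ∃ (ι κ : Type) (_ : Finite ι) (_ : Finite κ) (b : Basis (ι ⊕ ι ⊕ κ) R W)
        (_ : IsBlockBasis (β.restrict W) b) (b' : Basis (ι₀ ⊕ (ι ⊕ ι ⊕ κ)) R M),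
        (∀ i, b' (Sum.inl i) = v i) ∧ ∀ j, b' (Sum.inr j) = b j := by
    intro ι₀ _ _ v hv
    let W : Submodule R M := ⨅ i, LinearMap.ker (β (v i))
    have hW : ∀ w, w ∈ W ↔ ∀ i, β (v i) w = 0 := by simp [W]
    have hlt : finrank R W < r := by
      obtain ⟨b', -, -⟩ := exists_basis_of_existsUnique_orthogonal β v hv hW (finBasis R W)
      have := finrank_eq_nat_card_basis b'
      rw [Nat.card_sum, Nat.card_eq_fintype_card, Nat.card_eq_fintype_card, Fintype.card_fin] at this
      have : 0 < Fintype.card ι₀ := Fintype.card_pos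
      omega
    obtain ⟨ι, κ, _, _, b, hb⟩ := ih _ hlt W (β.restrict W) ⟨fun a b => hβ.eq a b⟩ rfl
    obtain ⟨b', h1, h2⟩ := exists_basis_of_existsUnique_orthogonal β v hv hW b
    exact ⟨W, fun i w hw => (hW w).mp hw i, ι, κ, inferInstance, inferInstance, b, hb, b', h1, h2⟩
  by_cases h1 : ∃ x, ∀ u w, β x x ∣ β u w
  · obtain ⟨x, hx⟩ := h1
    have hx0 : β x x ≠ 0 := fun h => hg (by simpa [h] using hx _ y)
    obtain ⟨W, hW, ι, κ, _, _, b, hb, b', hb1, hb2⟩ := key (fun _ : Unit => x) (by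
      intro u
      obtain ⟨c, hc⟩ := hx x u
      refine ⟨fun _ => c, ?_, ?_⟩
      · intro i
        simp [hc, mul_comm]
      · intro c' hc'
        have := hc' ()
        simp only [Finset.univ_unique, Finset.sum_singleton, map_sub, map_smul, smul_eq_mul,
          hc] at this
        ext ⟨⟩
        apply mul_left_cancel₀ hx0
        linear_combination -this)
    obtain ⟨b'', h⟩ := hb.snoc hβ (hW ()) hb1 hb2
    exact ⟨ι, Unit ⊕ κ, inferInstance, inferInstance, b'', h⟩
  · have hdiag : ∀ z, ∃ α, β z z = β x y * α ∧ ¬ IsUnit α := by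
      intro z
      obtain ⟨α, hα⟩ := hxy z z
      refine ⟨α, hα, fun hu => h1 ⟨z, fun u w => ?_⟩⟩
      rw [hα, hu.mul_right_dvd]
      exact hxy u w
    obtain ⟨α, hα, hαu⟩ := hdiag x
    obtain ⟨γ, hγ, -⟩ := hdiag y
    -- Up to sign and the factor (β x y)², this is the Gram determinant of x, y; it is a unit
    -- because no diagonal value attains the minimal valuation.
    have hu : IsUnit (1 - α * γ) := by
      apply IsLocalRing.isUnit_one_sub_self_of_mem_nonunits
      exact fun h => hαu (isUnit_of_mul_isUnit_left h)
    obtain ⟨ε, hε⟩ := hu.exists_right_inv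
    obtain ⟨W, hW, ι, κ, _, _, b, hb, b', hb1, hb2⟩ :=
      key (Sum.elim (fun _ : Unit => x) (fun _ : Unit => y)) (by
      intro u
      obtain ⟨p, hp⟩ := hxy x u
      obtain ⟨q, hq⟩ := hxy y u
      have hyx : β y x = β x y := (hβ.eq x y).symm
      -- Cramer's rule for p = α c₁ + c₂, q = c₁ + γ c₂, the orthogonality conditions divided by β x
      -- y.
      refine ⟨Sum.elim (fun _ => ε * (q - p * γ)) (fun _ => ε * (p - q * α)), ?_, ?_⟩
      · rintro (_ | _)
        · simp only [Sum.elim_inl, Fintype.sum_sum_type, Sum.elim_inr, Finset.univ_unique,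
            Finset.sum_singleton, map_sub, map_add, map_smul, smul_eq_mul, hp, hα]
          linear_combination -(β x y * p) * hε
        · simp only [Sum.elim_inl, Fintype.sum_sum_type, Sum.elim_inr, Finset.univ_unique,
            Finset.sum_singleton, map_sub, map_add, map_smul, smul_eq_mul, hq, hγ, hyx]
          linear_combination -(β x y * q) * hε
      · intro c hc
        have e1 := hc (Sum.inl ())
        have e2 := hc (Sum.inr ())
        simp only [Sum.elim_inl, Fintype.sum_sum_type, Sum.elim_inr, Finset.univ_unique,
            Finset.sum_singleton, map_sub, map_add, map_smul, smul_eq_mul, hp, hα, hq, hγ, hyx,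
            PUnit.default_eq_unit] at e1 e2
        have e1' : p = c (Sum.inl ()) * α + c (Sum.inr ()) :=
          mul_left_cancel₀ hg (by linear_combination e1)
        have e2' : q = c (Sum.inl ()) + c (Sum.inr ()) * γ :=
          mul_left_cancel₀ hg (by linear_combination e2)
        ext (⟨⟩ | ⟨⟩)
        · simp only [Sum.elim_inl, e1', e2']
          linear_combination -(c (Sum.inl ())) * hε
        · simp only [Sum.elim_inr, e1', e2']
          linear_combination -(c (Sum.inr ())) * hε)
    obtain ⟨b'', h⟩ := hb.snoc_pair hβ hW hb1 hb2
    exact ⟨Unit ⊕ ι, κ, inferInstance, inferInstance, b'', h⟩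

/-- A symmetric bilinear space over a discrete valuation ring has a basis adapted to an orthogonal
decomposition into blocks of rank `2` and at most one block of rank `1`. -/
theorem exists_isBlockBasis [Module.Free R M] [Module.Finite R M] {β : LinearMap.BilinForm R M}
    (hβ : β.IsSymm) :
    ∃ I J : ℕ, J ≤ 1 ∧ ∃ b : Basis (Fin I ⊕ Fin I ⊕ Fin J) R M, IsBlockBasis β b := by
  obtain ⟨ι, κ, _, _, b, hb⟩ := exists_isBlockBasis_aux _ M β hβ rfl
  -- Rank-one blocks are paired into blocks of rank two, leaving only the parity of their number.
  -- The bound J ≤ 1 is needed for the half-determinant and for the dimension count.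
  have hκ : Nat.card κ = Nat.card (Fin (Nat.card κ / 2) ⊕ Fin (Nat.card κ / 2) ⊕
      Fin (Nat.card κ % 2)) := by
    simp only [Nat.card_sum, Nat.card_fin]
    omega
  let e₁ := (Finite.card_eq.mp hκ).some
  let e₂ := Finite.equivFin (ι ⊕ Fin (Nat.card κ / 2))
  refine ⟨_, Nat.card κ % 2, by omega, b.reindex
    (((Equiv.refl ι).sumCongr ((Equiv.refl ι).sumCongr e₁)).trans
      (Equiv.trans
      { toFun := Sum.elim (fun i => .inl (.inl i)) (Sum.elim (fun i => .inr (.inl (.inl i)))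
          (Sum.elim (fun k => .inl (.inr k)) (Sum.elim (fun k => .inr (.inl (.inr k)))
            fun k => .inr (.inr k))))
        invFun := Sum.elim (Sum.elim .inl fun k => .inr (.inr (.inl k)))
          (Sum.elim (Sum.elim (fun i => .inr (.inl i)) fun k => .inr (.inr (.inr (.inl k))))
            fun k => .inr (.inr (.inr (.inr k))))
        left_inv := by rintro (_ | _ | _ | _ | _) <;> rfl
        right_inv := by rintro ((_ | _) | (_ | _) | _) <;> rfl }
      (e₂.sumCongr (e₂.sumCongr (Equiv.refl (Fin (Nat.card κ % 2))))))),
    hb.reindex _ ?_⟩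
  rintro (i | i | i) (j | j | j) h <;> simp [blockOf] at h <;> subst h <;> simp [blockOf]

end Splitting

/-! ### Normal form of quadratic forms -/

section BlockForm

open Module

theorem IsBlockBasis.isOrthogonalSum {R M : Type*} [CommRing R] [Nontrivial R] [AddCommGroup M]
    [Module R M] {β : LinearMap.BilinForm R M} {I J : ℕ} {b : Basis (Fin I ⊕ Fin I ⊕ Fin J) R M}
    (hb : IsBlockBasis β b) : IsOrthogonalSumOfRankOneOrTwo β := by
  classical
  let N : Fin I ⊕ Fin J → Submodule R M := fun k => Submodule.span R (b '' {i | blockOf i = k})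
  have hfin : ∀ k, Module.Free R (N k) ∧
      finrank R (N k) = Fintype.card {i : Fin I ⊕ Fin I ⊕ Fin J // blockOf i = k} := by
    intro k
    have hli : LinearIndependent R (fun i : {i // blockOf i = k} => b i) :=
      b.linearIndependent.comp _ Subtype.val_injective
    have hN : N k = Submodule.span R (Set.range fun i : {i // blockOf i = k} => b i) := by
      simp only [N, Set.image_eq_range]; rfl
    have hB := Basis.span hli
    rw [hN]
    exact ⟨Module.Free.of_basis hB, by rw [finrank_eq_card_basis hB]⟩
  have hint : ∀ k, finrank R (N k) = 1 ∨ finrank R (N k) = 2 := by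
    intro k
    rw [(hfin k).2, Fintype.card_subtype]
    rcases k with k | k
    · right
      rw [Finset.card_eq_two]
      refine ⟨Sum.inl k, Sum.inr (Sum.inl k), by simp, ?_⟩
      ext (i | i | i) <;> simp [blockOf]
    · left
      rw [Finset.card_eq_one]
      refine ⟨Sum.inr (Sum.inr k), ?_⟩
      ext (i | i | i) <;> simp [blockOf]
  have hind : iSupIndep N := by
    intro k
    refine (b.linearIndependent.disjoint_span_image (s := {i | blockOf i = k})
      (t := {i | blockOf i ≠ k}) ?_).mono_right ?_
    · exact Set.disjoint_left.mpr fun i h h' => h' h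
    · refine iSup₂_le fun j hj => Submodule.span_mono (Set.image_mono ?_)
      rintro i rfl
      exact hj
  have htop : iSup N = ⊤ := by
    rw [eq_top_iff, ← b.span_eq, Submodule.span_le]
    rintro _ ⟨i, rfl⟩
    exact Submodule.mem_iSup_of_mem (blockOf i) (Submodule.subset_span ⟨i, rfl, rfl⟩)
  refine ⟨I + J, N ∘ finSumFinEquiv.symm, ?_, fun i => ⟨(hfin _).1, hint _⟩, ?_⟩
  · rw [DirectSum.isInternal_submodule_iff_iSupIndep_and_iSup_eq_top]
    exact ⟨hind.comp finSumFinEquiv.symm.injective, by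
      rw [← htop]; exact finSumFinEquiv.symm.surjective.iSup_comp N⟩
  · intro i j hij x hx y hy
    have hne : finSumFinEquiv.symm i ≠ finSumFinEquiv.symm j := by simpa using hij
    refine Submodule.span_induction₂ (p := fun x y _ _ => β x y = 0) ?_ ?_ ?_ ?_ ?_ ?_ ?_ hx hy
    · rintro _ _ ⟨k, hk, rfl⟩ ⟨l, hl, rfl⟩
      refine hb k l ?_
      rw [hk, hl]
      exact hne
    all_goals simp +contextual

variable {S : Type*} [CommRing S]

/-- The terms at (i, j) and (j, i) cancel; the zero diagonal takes care of the fixed points of the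
swap. -/
lemma quadPoly_eq_zero_of_alternating {σ : Type*} [Fintype σ] {c : Matrix σ σ S}
    (h₀ : ∀ i, c i i = 0) (h : ∀ i j, c i j + c j i = 0) : quadPoly c = 0 := by
  classical
  rw [quadPoly, ← Finset.sum_product', ← Finset.univ_product_univ.symm]
  refine Finset.sum_involution (fun p _ => p.swap) ?_ ?_ (fun _ _ => Finset.mem_univ _)
    (fun _ _ => Prod.swap_swap _)
  · rintro ⟨i, j⟩ -
    have := congrArg (C (σ := σ)) (h i j)
    rw [C_add, C_0] at this
    simp only [Prod.swap]
    linear_combination X i * X j * this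
  · rintro ⟨i, j⟩ - hne heq
    obtain rfl : j = i := congrArg Prod.fst heq
    simp [h₀] at hne

/-- A matrix whose off-block entries are alternating represents a block form. -/
lemma quadPoly_eq_blockForm {I J : ℕ} (c : Matrix (Fin I ⊕ Fin I ⊕ Fin J) (Fin I ⊕ Fin I ⊕ Fin J) S)
    (h : ∀ i j, blockOf i ≠ blockOf j → c i j + c j i = 0) :
    quadPoly c = blockForm (fun i => c (.inl i) (.inl i))
      (fun i => c (.inl i) (.inr (.inl i)) + c (.inr (.inl i)) (.inl i))
      (fun i => c (.inr (.inl i)) (.inr (.inl i))) (fun j => c (.inr (.inr j)) (.inr (.inr j))) := by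
  classical
  -- The block-diagonal part of `c`. The remainder is alternating, hence represents the zero form.
  let D : Matrix (Fin I ⊕ Fin I ⊕ Fin J) (Fin I ⊕ Fin I ⊕ Fin J) S :=
    Matrix.of fun i j => if blockOf i = blockOf j then c i j else 0
  have h1 : quadPoly (c - D) = 0 := by
    apply quadPoly_eq_zero_of_alternating
    · intro i; simp [D]
    · intro i j
      by_cases hij : blockOf i = blockOf j
      · simp [D, hij]
      · simpa [D, hij, Ne.symm hij] using h i j hij
  rw [← sub_add_cancel c D, quadPoly_add, h1, zero_add]
  simp [quadPoly, blockForm, D, blockOf, ite_mul, apply_ite (C (R := S) (σ := _)),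
    Finset.sum_add_distrib, add_mul]
  simp only [pow_two, mul_assoc, mul_comm (X (Sum.inr (Sum.inl _))) (X (Sum.inl _))]
  ring

lemma rename_quadPoly {σ τ : Type*} [Fintype σ] [Fintype τ] (e : σ ≃ τ) (c : Matrix σ σ S) :
    rename e (quadPoly c) = quadPoly (c.submatrix e.symm e.symm) := by
  simp only [quadPoly, map_sum, map_mul, rename_C, rename_X, Matrix.submatrix_apply]
  rw [← e.sum_comp]
  refine Finset.sum_congr rfl fun i _ => ?_
  rw [← e.sum_comp]
  simp

lemma formEquiv_iff {σ : Type*} [Fintype σ] [DecidableEq σ] {f g : MvPolynomial σ S} :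
    FormEquiv f g ↔ ∃ A B : Matrix σ σ S, A * B = 1 ∧ B * A = 1 ∧ subst A f = g :=
  ⟨fun ⟨A, h⟩ => ⟨A, A⁻¹.1, A.mul_inv, A.inv_mul, h⟩, fun ⟨A, B, h1, h2, h⟩ => ⟨⟨A, B, h1, h2⟩, h⟩⟩

/-- Over a discrete valuation ring, a quadratic form is equivalent to a block form with at most one
block of size one. -/
theorem exists_formEquiv_blockForm [IsDomain S] [IsDiscreteValuationRing S] (n : ℕ)
    {f : MvPolynomial (Fin (n + 1)) S} (hf : f.IsHomogeneous 2) :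
    ∃ I J : ℕ, J ≤ 1 ∧ 2 * I + J = n + 1 ∧
      ∃ (e : Fin I ⊕ Fin I ⊕ Fin J ≃ Fin (n + 1)) (a b c : Fin I → S) (d : Fin J → S),
        FormEquiv f (rename e (blockForm a b c d)) := by
  obtain ⟨c, rfl⟩ := exists_eq_quadPoly hf
  -- The polar form is used, not a symmetric Gram matrix of f, so no division by 2 occurs. It
  -- controls only the sums c_ij + c_ji, which is all that off-block entries require.
  obtain ⟨I, J, hJ, b, hb⟩ := exists_isBlockBasis (R := S) (M := Fin (n + 1) → S)
    (β := Matrix.toBilin' (c + c.transpose)) ⟨fun x y => by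
      change Matrix.toBilin' _ x y = Matrix.toBilin' _ y x
      rw [Matrix.toBilin'_apply', Matrix.toBilin'_apply',
        Matrix.dotProduct_mulVec y, ← Matrix.mulVec_transpose, dotProduct_comm,
        Matrix.transpose_add, Matrix.transpose_transpose, add_comm c]⟩
  have hcard : Nat.card (Fin I ⊕ Fin I ⊕ Fin J) = Nat.card (Fin (n + 1)) := by
    rw [← finrank_eq_nat_card_basis b, ← finrank_eq_nat_card_basis (Pi.basisFun S (Fin (n + 1)))]
  let e := (Finite.card_eq.mp hcard).some
  let b' := b.reindex e
  let A := (Pi.basisFun S (Fin (n + 1))).toMatrix b'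
  let B := A.transpose * c * A
  have hB : ∀ i j, blockOf i ≠ blockOf j →
      B.submatrix e e i j + B.submatrix e e j i = 0 := by
    intro i j hij
    have h := hb i j hij
    rw [Matrix.toBilin'_apply'] at h
    have hcol : ∀ k, b k = A.transpose (e k) := by
      intro k
      ext l
      simp [A, b', Basis.toMatrix_apply]
    have hB : B + B.transpose = A.transpose * (c + c.transpose) * A := by
      simp [B, Matrix.mul_add, Matrix.add_mul, Matrix.mul_assoc]
    change (B + B.transpose) (e i) (e j) = 0
    rw [hB, Matrix.mul_mul_apply, ← hcol, ← hcol, h]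
  have hIJ : 2 * I + J = n + 1 := by
    simp only [Nat.card_sum, Nat.card_fin] at hcard
    omega
  refine ⟨I, J, hJ, hIJ, e, fun i => B.submatrix e e (.inl i) (.inl i),
    fun i => B.submatrix e e (.inl i) (.inr (.inl i)) + B.submatrix e e (.inr (.inl i)) (.inl i),
    fun i => B.submatrix e e (.inr (.inl i)) (.inr (.inl i)),
    fun j => B.submatrix e e (.inr (.inr j)) (.inr (.inr j)),
    formEquiv_iff.mpr ⟨A, b'.toMatrix (Pi.basisFun S _), Basis.toMatrix_mul_toMatrix_flip _ _,
      Basis.toMatrix_mul_toMatrix_flip _ _, ?_⟩⟩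
  rw [subst_quadPoly, ← quadPoly_eq_blockForm (B.submatrix e e) hB, rename_quadPoly]
  simp [B]

end BlockForm

/-! ### Points of the singular locus and singular vectors over fields -/

section Points

universe u

/-- The kernel of evaluation at `x` is prime but usually not homogeneous; its homogeneous core is
the desired point. It contains every form vanishing at `x`, and misses `X i` whenever the i-th
coordinate is nonzero. -/
lemma exists_mem_singularLocus {A K : Type*} [CommRing A] [CommRing K] [IsDomain K] {n : ℕ}
    {f : MvPolynomial (Fin (n + 1)) A} (hf : f.IsHomogeneous 2) (ψ : A →+* K)
    {x : Fin (n + 1) → K} (hx : x ≠ 0) (h : IsSingularAt (map ψ f) x) :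
    ∃ P ∈ singularLocus f, P.toSpec.asIdeal = RingHom.ker ψ := by
  obtain ⟨i, hi⟩ := Function.ne_iff.mp hx
  let Q : Ideal (MvPolynomial (Fin (n + 1)) A) := RingHom.ker (eval₂Hom ψ x)
  have hQ : Q.IsPrime := RingHom.ker_isPrime _
  have hmem : ∀ {g : MvPolynomial (Fin (n + 1)) A} {d : ℕ}, g.IsHomogeneous d →
      eval x (map ψ g) = 0 →
        g ∈ (Q.homogeneousCore (homogeneousSubmodule (Fin (n + 1)) A)).toIdeal := by
    intro g d hg h0
    refine Ideal.mem_homogeneousCore_of_homogeneous_of_mem ⟨d, hg⟩ ?_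
    rw [eval_map] at h0
    exact h0
  refine ⟨⟨Q.homogeneousCore _, hQ.homogeneousCore, fun hle => hi ?_⟩, ?_, ?_⟩
  · have hX : (X i : MvPolynomial (Fin (n + 1)) A) ∈
        HomogeneousIdeal.irrelevant (homogeneousSubmodule (Fin (n + 1)) A) := by
      rw [HomogeneousIdeal.mem_irrelevant_iff, GradedRing.proj_apply,
        DirectSum.decompose_of_mem_ne (i := 1) _ (isHomogeneous_X A i) one_ne_zero]
    have := Ideal.toIdeal_homogeneousCore_le _ Q (hle hX)
    simpa [Q, RingHom.mem_ker] using this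
  · rintro g (rfl | ⟨j, rfl⟩)
    · exact hmem hf h.1
    · exact hmem (hf.pderiv) (by rw [← pderiv_map]; exact h.2 j)
  · ext a
    constructor
    · intro ha
      have := Ideal.toIdeal_homogeneousCore_le _ Q ha
      simpa [Q, RingHom.mem_ker] using this
    · intro ha
      exact hmem (isHomogeneous_C _ a) (by simpa using ha)

/-- The tautological vector: the classes of the variables in the fraction field of A[x]/P. It is
nonzero because P does not contain the irrelevant ideal. -/
lemma exists_isSingularAt {A : Type u} [CommRing A] {n : ℕ} {f : MvPolynomial (Fin (n + 1)) A}
    {P : ProjSpace A n} (hP : P ∈ singularLocus f) :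
    ∃ (K : Type u) (_ : Field K) (ψ : A →+* K) (x : Fin (n + 1) → K), x ≠ 0 ∧
      IsSingularAt (map ψ f) x ∧ RingHom.ker ψ = P.toSpec.asIdeal := by
  let I := P.asHomogeneousIdeal.toIdeal
  have hI : I.IsPrime := P.isPrime
  let π : MvPolynomial (Fin (n + 1)) A →+* FractionRing (MvPolynomial (Fin (n + 1)) A ⧸ I) :=
    (algebraMap _ _).comp (Ideal.Quotient.mk I)
  have hker : RingHom.ker π = I := by
    rw [RingHom.ker_comp_of_injective _ (IsFractionRing.injective _ _), Ideal.mk_ker]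
  let ψ := π.comp C
  have hπ : ∀ g, eval (fun i => π (X i)) (map ψ g) = π g := by
    intro g
    rw [eval_map]
    have : eval₂Hom ψ (fun i => π (X i)) = π := by
      apply ringHom_ext <;> simp [ψ]
    exact congrArg (fun φ => φ g) this
  have hmem : ∀ g ∈ insert f (Set.range fun i => pderiv i f), π g = 0 := by
    intro g hg
    rw [← RingHom.mem_ker, hker]
    exact hP hg
  refine ⟨FractionRing (MvPolynomial (Fin (n + 1)) A ⧸ I), inferInstance, ψ, fun i => π (X i),
    ?_, ⟨?_, fun i => ?_⟩, ?_⟩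
  · intro hx
    refine P.not_irrelevant_le fun g hg => ?_
    rw [HomogeneousIdeal.mem_irrelevant_iff, GradedRing.proj_apply] at hg
    have hg0 : constantCoeff g = 0 := by
      have : homogeneousComponent 0 g = 0 := by rwa [← decomposition.decompose'_apply]
      rwa [homogeneousComponent_zero, C_eq_zero] at this
    change g ∈ I
    rw [← hker, RingHom.mem_ker, ← hπ, hx]
    change eval (0 : Fin (n + 1) → _) (map ψ g) = 0
    rw [eval_zero, constantCoeff_map, hg0, map_zero]
  · rw [hπ]
    exact hmem _ (Set.mem_insert _ _)
  · rw [pderiv_map, hπ]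
    exact hmem _ (Set.mem_insert_of_mem _ ⟨i, rfl⟩)
  · rw [← RingHom.comap_ker, hker]
    rfl

end Points

/-! ### The generic form and the ideal of the discriminant locus -/

section GenericForm

variable {S T : Type*} [CommRing S] [CommRing T] {n d : ℕ}

lemma mem_expo_iff {s : Fin (n + 1) →₀ ℕ} :
    s ∈ (Finset.univ : Finset (Fin (n + 1))).finsuppAntidiag d ↔ s.degree = d := by
  rw [Finset.mem_finsuppAntidiag, Finsupp.degree_eq_sum]
  simp

/-- The form of degree `d` with given coefficients. -/
def formOf (ρ : Expo n d → S) : MvPolynomial (Fin (n + 1)) S := ∑ s : Expo n d, monomial s.1 (ρ s)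

lemma map_formOf (ψ : S →+* T) (ρ : Expo n d → S) : map ψ (formOf ρ) = formOf (ψ ∘ ρ) := by
  simp [formOf]

lemma isHomogeneous_formOf (ρ : Expo n d → S) : (formOf ρ).IsHomogeneous d :=
  IsHomogeneous.sum _ _ _ fun s _ => isHomogeneous_monomial _ (mem_expo_iff.mp s.2)

lemma coeff_formOf (ρ : Expo n d → S) (s : Expo n d) : coeff s.1 (formOf ρ) = ρ s := by
  classical
  simp [formOf, coeff_sum, coeff_monomial]

lemma formOf_coeff {f : MvPolynomial (Fin (n + 1)) S} (hf : f.IsHomogeneous d) :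
    formOf (fun s : Expo n d => coeff s.1 f) = f := by
  ext s
  by_cases hs : s.degree = d
  · exact coeff_formOf _ ⟨s, mem_expo_iff.mpr hs⟩
  · rw [(isHomogeneous_formOf _).coeff_eq_zero hs, hf.coeff_eq_zero hs]

lemma map_genericForm (ρ : Expo n d → S) :
    map (aeval ρ : CoeffRing n d →ₐ[ℤ] S).toRingHom (genericForm n d) = formOf ρ := by
  simp [genericForm, formOf]

lemma isHomogeneous_genericForm : (genericForm n d).IsHomogeneous d :=
  isHomogeneous_formOf _

lemma evalAtForm_formOf (G : CoeffRing n d) (ρ : Expo n d → S) :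
    evalAtForm G (formOf ρ) = aeval ρ G := by
  simp only [evalAtForm, coeff_formOf]

lemma map_evalAtForm (ψ : S →+* T) (G : CoeffRing n d) (f : MvPolynomial (Fin (n + 1)) S) :
    ψ (evalAtForm G f) = evalAtForm G (map ψ f) := by
  simp only [evalAtForm, coeff_map]
  exact (congrArg (fun φ : CoeffRing n d →+* T => φ G) (ringHom_ext (by simp) (by simp) :
    ψ.comp (aeval (fun s : Expo n d => coeff s.1 f) : CoeffRing n d →ₐ[ℤ] S).toRingHom =
      (aeval (fun s : Expo n d => ψ (coeff s.1 f)) : CoeffRing n d →ₐ[ℤ] T).toRingHom))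

/-- The ideal of polynomials vanishing on the locus of singular quadrics. -/
def discriminantIdeal (n : ℕ) : Ideal (CoeffRing n 2) :=
  PrimeSpectrum.vanishingIdeal (discriminantLocus n 2)

/-- A singular form over a domain is a specialization of the generic form, and the kernel of the
specialization map is a point of D. With the next lemma, membership in the ideal means vanishing on
all singular forms over fields. -/
lemma evalAtForm_eq_zero [IsDomain S] {G : CoeffRing n 2} (hG : G ∈ discriminantIdeal n)
    {f : MvPolynomial (Fin (n + 1)) S} (hf : f.IsHomogeneous 2) {x : Fin (n + 1) → S} (hx : x ≠ 0)
    (h : IsSingularAt f x) : evalAtForm G f = 0 := by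
  rw [← formOf_coeff hf, ← map_genericForm] at h
  obtain ⟨P, hP, hker⟩ := exists_mem_singularLocus isHomogeneous_genericForm _ hx h
  have := (PrimeSpectrum.mem_vanishingIdeal _ _).mp hG _ ⟨P, hP, rfl⟩
  rw [hker] at this
  exact this

lemma mem_discriminantIdeal {G : CoeffRing n 2}
    (h : ∀ (K : Type) [Field K] (f : MvPolynomial (Fin (n + 1)) K) (x : Fin (n + 1) → K),
      f.IsHomogeneous 2 → x ≠ 0 → IsSingularAt f x → evalAtForm G f = 0) :
    G ∈ discriminantIdeal n := by
  refine (PrimeSpectrum.mem_vanishingIdeal _ _).mpr ?_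
  rintro _ ⟨P, hP, rfl⟩
  obtain ⟨K, _, ψ, x, hx, hs, hker⟩ := exists_isSingularAt hP
  have hψ : ψ = (aeval (fun s => ψ (X s)) : CoeffRing n 2 →ₐ[ℤ] K).toRingHom :=
    ringHom_ext (by simp) (by simp)
  have h0 := h K _ x ((isHomogeneous_genericForm).map ψ) hx hs
  rw [hψ, map_genericForm, evalAtForm_formOf] at h0
  rw [← hker, RingHom.mem_ker, hψ]
  exact h0

end GenericForm

/-! ### A criterion for a prime ideal of A[X] to be principal -/

section PrincipalPrime

open Polynomial in
/-- A nonzero prime ideal of `A[X]`, `A` factorial, which meets `A` trivially is principal. -/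
theorem isPrincipal_of_comap_C_eq_bot {A : Type*} [CommRing A] [IsDomain A]
    [UniqueFactorizationMonoid A] (I : Ideal A[X]) [hI : I.IsPrime] (h0 : I ≠ ⊥)
    (hC : ∀ a : A, Polynomial.C a ∈ I → a = 0) : ∃ p, I = Ideal.span {p} := by
  classical
  -- The generator will be a prime element of I of least degree. Every nonzero element of I has a
  -- prime factor in I, so that degree is least in all of I.
  have hex : ∃ d, ∃ p ∈ I, Prime p ∧ p.natDegree = d := by
    obtain ⟨p, hp, hpp⟩ := hI.exists_mem_prime_of_ne_bot h0
    exact ⟨_, p, hp, hpp, rfl⟩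
  obtain ⟨p, hp, hpp, hpd⟩ := Nat.find_spec hex
  have hmin : ∀ q ∈ I, q ≠ 0 → p.natDegree ≤ q.natDegree := by
    intro q hq hq0
    have : ∀ s : Multiset A[X], s.prod ∣ q → (∀ r ∈ s, Prime r) → s.prod ∈ I →
        p.natDegree ≤ q.natDegree := by
      intro s hs hsp hsI
      obtain ⟨r, hr, hrI⟩ := (hI.multiset_prod_mem_iff_exists_mem s).mp hsI
      rw [hpd]
      exact (Nat.find_min' hex ⟨r, hrI, hsp r hr, rfl⟩).trans
        (Polynomial.natDegree_le_of_dvd ((Multiset.dvd_prod hr).trans hs) hq0)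
    obtain ⟨s, hs, hsq⟩ := UniqueFactorizationMonoid.exists_prime_factors q hq0
    obtain ⟨u, rfl⟩ := hsq
    exact this s (dvd_mul_right _ _) hs ((I.mul_unit_mem_iff_mem u.isUnit).mp hq)
  have hlc : ¬ p ∣ Polynomial.C p.leadingCoeff := by
    intro h
    have := Polynomial.natDegree_le_of_dvd h
      (Polynomial.C_ne_zero.mpr (Polynomial.leadingCoeff_ne_zero.mpr hpp.ne_zero))
    rw [Polynomial.natDegree_C, Nat.le_zero] at this
    rw [Polynomial.eq_C_of_natDegree_eq_zero this] at hp hpp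
    exact hpp.ne_zero (by rw [hC _ hp, Polynomial.C_0])
  refine ⟨p, le_antisymm ?_ ((Ideal.span_singleton_le_iff_mem I).mpr hp)⟩
  suffices h : ∀ (d : ℕ) (q : A[X]), q.natDegree = d → q ∈ I → p ∣ q from
    fun q hq => Ideal.mem_span_singleton.mpr (h _ q rfl hq)
  intro d
  induction d using Nat.strong_induction_on with
  | _ d ih =>
  intro q hqd hq
  by_cases hq0 : q = 0
  · simp [hq0]
  have hle := hmin q hq hq0
  -- One step of pseudo-division lowers the degree at the cost of multiplying `q` by the leading
  -- coefficient of `p`, which the prime `p` does not divide.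
  have hr : p.cancelLeads q ∈ I :=
    I.sub_mem (I.mul_mem_left _ hq) (I.mul_mem_left _ hp)
  have hdvd : p ∣ p.cancelLeads q := by
    by_cases hqz : q.natDegree = 0
    · rw [Polynomial.eq_C_of_natDegree_eq_zero hqz] at hq hq0
      exact absurd (by rw [hC _ hq, Polynomial.C_0]) hq0
    · exact ih _ (hqd ▸ Polynomial.natDegree_cancelLeads_lt_of_natDegree_le_natDegree hle
        (Nat.pos_of_ne_zero hqz)) _ rfl hr
  have : p ∣ Polynomial.C p.leadingCoeff * q := by
    have h2 := dvd_add hdvd (dvd_mul_left p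
      (Polynomial.C q.leadingCoeff * Polynomial.X ^ (q.natDegree - p.natDegree)))
    rwa [Polynomial.cancelLeads, sub_add_cancel, Nat.sub_eq_zero_of_le hle, pow_zero,
      mul_one] at h2
  exact (hpp.dvd_or_dvd this).resolve_left hlc

end PrincipalPrime

/-! ### Existence of the discriminant -/

section Ideal

/-- The substitution moves every vector along `x`, a direction of invariance of f. Evaluation at the
tautological vector `X` turns this into an identity of polynomials. -/
lemma subst_eq_of_isSingularAt {S σ : Type*} [CommRing S] [Fintype σ] [DecidableEq σ]
    {f : MvPolynomial σ S} (hf : f.IsHomogeneous 2) {x : σ → S} (h : IsSingularAt f x)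
    (e : σ → S) : subst (1 - Matrix.vecMulVec x e) f = f := by
  have hX : ∀ g : MvPolynomial σ S, eval X (MvPolynomial.map C g) = g := fun g => by
    rw [eval_map, eval₂_eta]
  rw [← hX (subst _ f), map_subst, eval_subst]
  have : ((1 - Matrix.vecMulVec x e).map C).mulVec (X : σ → MvPolynomial σ S) =
      X + (-(C ∘ e ⬝ᵥ X)) • (C ∘ x) := by
    ext1 i
    simp [Matrix.mulVec, dotProduct, Matrix.vecMulVec_apply, Matrix.one_apply, sub_mul,
      Finset.sum_sub_distrib, apply_ite (C (R := S) (σ := σ)), ite_mul, mul_assoc,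
      ← Finset.mul_sum]
    ring
  rw [this, (h.map C).eval_add (hf.map C), hX]

variable (n : ℕ)

/-- D is irreducible because it is parametrized by an affine space: the ideal is the kernel of a map
to a polynomial ring, given by the coefficients of one explicit singular form. -/
instance isPrime_discriminantIdeal : (discriminantIdeal n).IsPrime := by
  let S := MvPolynomial (Expo n 2 ⊕ Fin (n + 1) ⊕ Fin (n + 1)) ℤ
  let t : Fin (n + 1) → S := fun i => X (.inr (.inl i))
  let e : Fin (n + 1) → S := fun i => X (.inr (.inr i))
  -- A multiple of the projection along `t`: B t = (e·t) t - t (e·t) = 0, so any form pulled back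
  -- along `B` is singular at `t`.
  let B : Matrix (Fin (n + 1)) (Fin (n + 1)) S := (e ⬝ᵥ t) • 1 - Matrix.vecMulVec t e
  let F : MvPolynomial (Fin (n + 1)) S := formOf fun s : Expo n 2 => X (.inl s)
  have hF : F.IsHomogeneous 2 := isHomogeneous_formOf _
  let φ : CoeffRing n 2 →+* S :=
    (aeval fun s : Expo n 2 => coeff s.1 (subst B F) : CoeffRing n 2 →ₐ[ℤ] S).toRingHom
  suffices h : discriminantIdeal n = RingHom.ker φ by
    rw [h]
    exact RingHom.ker_isPrime φ
  ext G
  constructor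
  · intro hG
    have ht : t ≠ 0 := fun h => X_ne_zero (R := ℤ) _ (congrFun h 0)
    refine evalAtForm_eq_zero hG (isHomogeneous_subst B hF) ht
      (IsSingularAt.subst hF (isSingularAt_zero hF) (r := 0) ?_)
    rw [zero_smul, Matrix.sub_mulVec, Matrix.smul_mulVec, Matrix.one_mulVec]
    ext1 i
    simp only [Pi.sub_apply, Pi.smul_apply, Matrix.mulVec, dotProduct, Matrix.vecMulVec_apply,
      mul_assoc, ← Finset.mul_sum, smul_eq_mul, Pi.zero_apply]
    ring
  · intro hG
    refine mem_discriminantIdeal fun K _ f x hf hx h => ?_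
    obtain ⟨i, hi⟩ := Function.ne_iff.mp hx
    -- Here `t` becomes the singular vector x and `e` is chosen with e·t = 1; then `B` becomes 1 - x
    -- eᵀ, which fixes f.
    let sp : S →+* K := eval₂Hom (Int.castRingHom K)
      (Sum.elim (fun s : Expo n 2 => coeff s.1 f) (Sum.elim x (Pi.single i (x i)⁻¹)))
    have sp_X : ∀ v, sp (X v) = Sum.elim (fun s : Expo n 2 => coeff s.1 f)
        (Sum.elim x (Pi.single i (x i)⁻¹)) v := fun v => eval₂Hom_X' _ _ _
    have hsp : map sp (subst B F) = f := by
      rw [map_subst, map_formOf]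
      have h1 : formOf (sp ∘ fun s : Expo n 2 => (X (.inl s) : S)) = f := by
        conv_rhs => rw [← formOf_coeff hf]
        congr 1
        ext s
        simp [sp_X]
      have h2 : B.map sp = 1 - Matrix.vecMulVec x (Pi.single i (x i)⁻¹) := by
        have h3 : sp (e ⬝ᵥ t) = 1 := by
          have : x i ≠ 0 := hi
          simp [dotProduct, e, t, sp_X, this, Pi.single_apply]
        ext k l
        simp only [B, Matrix.map_apply, Matrix.sub_apply, Matrix.smul_apply, smul_eq_mul, map_sub,
          map_mul, h3, Matrix.vecMulVec_apply, one_mul, Matrix.one_apply]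
        simp [sp_X, t, e, apply_ite sp]
      rw [h1, h2, subst_eq_of_isSingularAt hf h]
    rw [← hsp, ← map_evalAtForm]
    have h0 : evalAtForm G (subst B F) = 0 := hG
    rw [h0, map_zero]

variable {n}

/-- The zero form over ℚ is singular, so D has a point of characteristic zero. -/
lemma intCast_notMem_discriminantIdeal {z : ℤ} (hz : z ≠ 0) :
    (C z : CoeffRing n 2) ∉ discriminantIdeal n := by
  intro h
  have := evalAtForm_eq_zero (S := ℚ) h (isHomogeneous_zero _ _ 2) (x := 1)
    (fun h => one_ne_zero (congrFun h 0)) ⟨by simp, by simp⟩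
  simp [evalAtForm] at this
  exact hz this

lemma formOf_add {S : Type*} [CommRing S] {d : ℕ} (ρ ρ' : Expo n d → S) :
    formOf (ρ + ρ') = formOf ρ + formOf ρ' := by
  simp [formOf, Finset.sum_add_distrib]

lemma isSingularAt_quadPoly_of_mulVec_eq_zero {K σ : Type*} [Field K] [CharZero K] [Fintype σ]
    {c : Matrix σ σ K} {x : σ → K} (h : (c + c.transpose).mulVec x = 0) :
    IsSingularAt (quadPoly c) x := by
  refine ⟨?_, fun i => by rw [eval_pderiv_quadPoly, h, Pi.zero_apply]⟩
  have h1 := eval_add_quadPoly c x x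
  rw [h, dotProduct_zero, add_zero, eval_quadPoly, eval_quadPoly, Matrix.mulVec_add,
    add_dotProduct, dotProduct_add] at h1
  rw [eval_quadPoly]
  have h2 : (2 : K) * (x ⬝ᵥ c.mulVec x) = 0 := by linear_combination h1
  exact (mul_eq_zero.mp h2).resolve_left two_ne_zero

/-- A symmetric matrix with nondegenerate minor becomes singular after changing its corner. -/
lemma exists_mulVec_eq_zero_of_det_submatrix_ne_zero {K : Type*} [Field K] [CharZero K]
    (M : Matrix (Fin (n + 1)) (Fin (n + 1)) K)
    (hM : (M.submatrix Fin.succ Fin.succ).det ≠ 0) :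
    ∃ (a : K) (x : Fin (n + 1) → K), x ≠ 0 ∧
      (M + Matrix.single 0 0 (2 * a)).mulVec x = 0 := by
  let N := M.submatrix Fin.succ Fin.succ
  -- The vector (1, t) is made to satisfy all rows but the first; the corner entry is then adjusted
  -- for the first row.
  let t : Fin n → K := -(N⁻¹.mulVec fun i => M i.succ 0)
  let x : Fin (n + 1) → K := Fin.cons 1 t
  refine ⟨-(M.mulVec x 0) / 2, x, fun h => one_ne_zero (congrFun h 0), ?_⟩
  have hN : N.mulVec t = -fun i => M i.succ 0 := by
    rw [Matrix.mulVec_neg, Matrix.mulVec_mulVec, Matrix.mul_nonsing_inv _ hM.isUnit,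
      Matrix.one_mulVec]
  ext i
  rw [Matrix.add_mulVec, Pi.add_apply]
  refine Fin.cases ?_ (fun i => ?_) i
  · simp [Matrix.mulVec, dotProduct, Fin.sum_univ_succ, x, Matrix.single]
    ring
  · have := congrFun hN i
    simp only [Matrix.mulVec, dotProduct, N, Matrix.submatrix_apply, Pi.neg_apply] at this
    simp [Matrix.mulVec, dotProduct, Fin.sum_univ_succ, x, this, Matrix.single,
      (Fin.succ_ne_zero i).symm]

/-- The generic quadratic form is attached to a matrix over the ring of coefficients. -/
lemma exists_genericForm_eq_quadPoly (n : ℕ) :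
    ∃ c : Matrix (Fin (n + 1)) (Fin (n + 1)) (CoeffRing n 2), genericForm n 2 = quadPoly c :=
  exists_eq_quadPoly isHomogeneous_genericForm

/-- A matrix to which the generic quadratic form is attached. -/
def genericMatrix (n : ℕ) : Matrix (Fin (n + 1)) (Fin (n + 1)) (CoeffRing n 2) :=
  (exists_genericForm_eq_quadPoly n).choose

/-- The Hessian matrix of the generic quadratic form. -/
def genericHessian (n : ℕ) : Matrix (Fin (n + 1)) (Fin (n + 1)) (CoeffRing n 2) :=
  genericMatrix n + (genericMatrix n).transpose

lemma formOf_eq_quadPoly {S : Type*} [CommRing S] (ρ : Expo n 2 → S) :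
    formOf ρ = quadPoly ((genericMatrix n).map (aeval ρ : CoeffRing n 2 →ₐ[ℤ] S)) := by
  rw [← map_genericForm, (exists_genericForm_eq_quadPoly n).choose_spec, map_quadPoly]
  rfl

lemma map_genericHessian {S : Type*} [CommRing S] {ρ : Expo n 2 → S}
    {c : Matrix (Fin (n + 1)) (Fin (n + 1)) S} (h : formOf ρ = quadPoly c) :
    (genericHessian n).map (aeval ρ : CoeffRing n 2 →ₐ[ℤ] S) = c + c.transpose := by
  rw [← add_transpose_eq_of_quadPoly_eq ((formOf_eq_quadPoly ρ).symm.trans h)]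
  ext i j
  simp [genericHessian]

lemma evalAtForm_det_genericHessian {S : Type*} [CommRing S]
    (c : Matrix (Fin (n + 1)) (Fin (n + 1)) S) :
    evalAtForm (genericHessian n).det (quadPoly c) = (c + c.transpose).det := by
  rw [evalAtForm, AlgHom.map_det, AlgHom.mapMatrix_apply,
    map_genericHessian (formOf_coeff (isHomogeneous_quadPoly c))]

lemma det_genericHessian_mem : (genericHessian n).det ∈ discriminantIdeal n := by
  refine mem_discriminantIdeal fun K _ f x hf hx h => ?_
  obtain ⟨c, rfl⟩ := exists_eq_quadPoly hf
  rw [evalAtForm_det_genericHessian, ← Matrix.exists_mulVec_eq_zero_iff]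
  exact ⟨x, hx, funext fun i => by simpa [eval_pderiv_quadPoly] using h.2 i⟩

lemma det_genericHessian_ne_zero : (genericHessian n).det ≠ 0 := by
  intro h
  have := evalAtForm_det_genericHessian (n := n) (1 : Matrix _ _ ℤ)
  rw [h, Matrix.transpose_one, ← two_smul ℤ, Matrix.det_smul, Matrix.det_one] at this
  simp only [evalAtForm, map_zero, mul_one, Fintype.card_fin] at this
  exact pow_ne_zero _ two_ne_zero this.symm

/-- The exponent of `x_0²`. -/
def cornerExpo (n : ℕ) : Expo n 2 := ⟨Finsupp.single 0 2, mem_expo_iff.mpr (by simp)⟩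

/-- No nonzero element of the ideal is free of the coefficient of `x_0²`. -/
lemma eq_zero_of_rename_mem (g : MvPolynomial {s : Expo n 2 // s ≠ cornerExpo n} ℤ)
    (hg : rename Subtype.val g ∈ discriminantIdeal n) : g = 0 := by
  classical
  let ext {T : Type} [CommRing T] (ρ : {s : Expo n 2 // s ≠ cornerExpo n} → T) : Expo n 2 → T :=
    fun s => if h : s = cornerExpo n then 0 else ρ ⟨s, h⟩
  -- The Hessian minor without row and column 0, which does not involve the coefficient of x_0².
  -- Where it is nonzero, that coefficient can be chosen over ℚ to make the form singular, which
  -- forces `g` to vanish there.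
  let δ : MvPolynomial {s : Expo n 2 // s ≠ cornerExpo n} ℤ :=
    aeval (ext X) ((genericHessian n).submatrix Fin.succ Fin.succ).det
  have hδ : ∀ {T : Type} [CommRing T] (ρ : {s : Expo n 2 // s ≠ cornerExpo n} → T)
      {c : Matrix (Fin (n + 1)) (Fin (n + 1)) T}, formOf (ext ρ) = quadPoly c →
      aeval ρ δ = ((c + c.transpose).submatrix Fin.succ Fin.succ).det := by
    intro T _ ρ c hc
    have h1 : (aeval ρ).comp (aeval (ext X) : CoeffRing n 2 →ₐ[ℤ] _) = aeval (ext ρ) := by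
      apply algHom_ext
      intro s
      by_cases hs : s = cornerExpo n <;> simp [ext, hs]
    rw [← map_genericHessian hc, ← h1, Matrix.submatrix_map, ← AlgHom.mapMatrix_apply,
      ← AlgHom.map_det]
    rfl
  have hδ0 : δ ≠ 0 := by
    intro h0
    -- The form x_1² + ⋯ + x_n², for which the minor is 2ⁿ.
    let D : Matrix (Fin (n + 1)) (Fin (n + 1)) ℤ := Matrix.diagonal (Fin.cons 0 fun _ => 1)
    have h1 : ext (fun s => coeff s.1.1 (quadPoly D)) = fun s => coeff s.1 (quadPoly D) := by
      ext s
      by_cases hs : s = cornerExpo n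
      · simp only [ext, hs, dif_pos, cornerExpo, quadPoly, coeff_sum]
        refine (Finset.sum_eq_zero fun i _ => Finset.sum_eq_zero fun j _ => ?_).symm
        by_cases hij : i = j
        · subst hij
          rw [mul_assoc, ← pow_two, coeff_C_mul, X_pow_eq_monomial, coeff_monomial]
          by_cases hi : i = 0
          · simp [D, hi]
          · rw [if_neg, mul_zero]
            intro h
            exact hi ((Finsupp.single_left_inj two_ne_zero).mp h)
        · simp [D, hij]
      · simp [ext, hs]
    have h2 := hδ (fun s => coeff s.1.1 (quadPoly D)) (c := D)
      (by rw [h1, formOf_coeff (isHomogeneous_quadPoly _)])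
    rw [h0, map_zero] at h2
    have h3 : (D + D.transpose).submatrix Fin.succ Fin.succ = Matrix.diagonal fun _ => 2 := by
      ext i j
      by_cases hij : i = j
      · simp [D, Matrix.diagonal, hij]
      · simp [D, Matrix.diagonal, hij, Ne.symm hij]
    rw [h3, Matrix.det_diagonal] at h2
    simp only [Finset.prod_const] at h2
    exact pow_ne_zero _ two_ne_zero h2.symm
  suffices h : g * δ = 0 from (mul_eq_zero.mp h).resolve_right hδ0
  refine MvPolynomial.funext fun ρ => ?_
  rw [map_mul, map_zero, mul_eq_zero, or_iff_not_imp_right]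
  intro hρ
  let ρ' : {s : Expo n 2 // s ≠ cornerExpo n} → ℚ := fun s => ρ s
  have hcast : ∀ q : MvPolynomial {s : Expo n 2 // s ≠ cornerExpo n} ℤ,
      aeval ρ' q = ((eval ρ q : ℤ) : ℚ) := by
    intro q
    exact congrArg (fun φ : MvPolynomial {s : Expo n 2 // s ≠ cornerExpo n} ℤ →+* ℚ => φ q)
      (ringHom_ext (by simp) (by simp [ρ']) :
        (aeval ρ' : _ →ₐ[ℤ] ℚ).toRingHom = (Int.castRingHom ℚ).comp (eval ρ))
  let c := (genericMatrix n).map (aeval (ext ρ') : CoeffRing n 2 →ₐ[ℤ] ℚ)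
  have hc : formOf (ext ρ') = quadPoly c := formOf_eq_quadPoly _
  obtain ⟨a, x, hx, hax⟩ := exists_mulVec_eq_zero_of_det_submatrix_ne_zero (c + c.transpose)
    (by rw [← hδ ρ' hc, hcast]; exact_mod_cast hρ)
  have hsum : formOf (ext ρ' + Pi.single (cornerExpo n) a) =
      quadPoly (c + Matrix.single 0 0 a) := by
    rw [formOf_add, quadPoly_add, hc, quadPoly_single]
    congr 1
    rw [formOf, Finset.sum_eq_single (cornerExpo n)]
    · simp [cornerExpo, mul_assoc, ← pow_two, X_pow_eq_monomial, C_mul_monomial]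
    · intro s _ hs
      simp [hs]
    · simp
  have hsing : IsSingularAt (quadPoly (c + Matrix.single 0 0 a)) x := by
    apply isSingularAt_quadPoly_of_mulVec_eq_zero
    rw [← hax]
    congr 1
    rw [Matrix.transpose_add, Matrix.transpose_single, two_mul, Matrix.single_add]
    abel
  have h0 := evalAtForm_eq_zero hg (isHomogeneous_quadPoly _) hx hsing
  rw [← hsum, evalAtForm_formOf, aeval_rename] at h0
  have hext : (ext ρ' + Pi.single (cornerExpo n) a) ∘ Subtype.val = ρ' := by
    funext s
    simp [ext, s.2]
  rw [hext, hcast] at h0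
  exact_mod_cast h0

/-- The coefficient of x_0² is singled out as the polynomial variable, so that the criterion for
principal primes applies. -/
theorem exists_isDiscriminant (n : ℕ) : ∃ Δ : CoeffRing n 2, IsDiscriminant n 2 Δ := by
  classical
  let e : CoeffRing n 2 ≃ₐ[ℤ] Polynomial (MvPolynomial {s : Expo n 2 // s ≠ cornerExpo n} ℤ) :=
    (renameEquiv ℤ (Equiv.optionSubtypeNe (cornerExpo n)).symm).trans (optionEquivLeft ℤ _)
  have he : ∀ g, e.symm (Polynomial.C g) = rename Subtype.val g := by
    intro g
    rw [AlgEquiv.symm_apply_eq]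
    have : (Polynomial.CAlgHom : MvPolynomial {s : Expo n 2 // s ≠ cornerExpo n} ℤ →ₐ[ℤ] _) = e.toAlgHom.comp (rename Subtype.val) := by
      apply algHom_ext
      intro s
      simp [e, Equiv.optionSubtypeNe_symm_of_ne s.2]
    exact congrArg (fun φ => φ g) this
  let I := (discriminantIdeal n).comap e.symm.toAlgHom.toRingHom
  have hI : I.IsPrime := (isPrime_discriminantIdeal n).comap _
  obtain ⟨p, hp⟩ := isPrincipal_of_comap_C_eq_bot I (by
      intro h
      refine det_genericHessian_ne_zero (n := n) (e.injective ?_)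
      rw [map_zero, ← Ideal.mem_bot, ← h]
      simpa [I, Ideal.mem_comap] using det_genericHessian_mem)
    (fun g hg => eq_zero_of_rename_mem g (by rw [← he]; exact hg))
  refine ⟨e.symm p, ?_⟩
  change discriminantIdeal n = _
  ext G
  have : G ∈ discriminantIdeal n ↔ e G ∈ I := by simp [I, Ideal.mem_comap]
  rw [this, hp, Ideal.mem_span_singleton, Ideal.mem_span_singleton]
  exact ⟨fun ⟨q, hq⟩ => ⟨e.symm q, by rw [← map_mul, ← hq, e.symm_apply_apply]⟩,
    fun ⟨q, hq⟩ => ⟨e q, by rw [hq, map_mul, e.apply_symm_apply]⟩⟩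

end Ideal

/-! ### Block forms: Hessian determinant and singular vectors -/

section BlockMatrix

variable {S T : Type*} [CommRing S] [CommRing T] {I J : ℕ}
  (a b c : Fin I → S) (d : Fin J → S)

/-- The discriminants `4 a_i c_i - b_i²` and `d_j` of the blocks of a block form. -/
def blockDisc : Fin I ⊕ Fin J → S := Sum.elim (fun i => 4 * a i * c i - b i ^ 2) d

/-- An upper triangular matrix representing a block form. -/
def blockMatrix : Matrix (Fin I ⊕ Fin I ⊕ Fin J) (Fin I ⊕ Fin I ⊕ Fin J) S :=
  Matrix.fromBlocks (Matrix.diagonal a) (Matrix.fromCols (Matrix.diagonal b) 0) 0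
    (Matrix.fromBlocks (Matrix.diagonal c) 0 0 (Matrix.diagonal d))

lemma quadPoly_blockMatrix : quadPoly (blockMatrix a b c d) = blockForm a b c d := by
  rw [quadPoly_eq_blockForm]
  · simp [blockMatrix]
  · rintro (i | i | i) (j | j | j) h <;> simp [blockMatrix, blockOf] at h ⊢ <;> simp [h, Ne.symm h]

lemma det_blockMatrix_add_transpose :
    (blockMatrix a b c d + (blockMatrix a b c d).transpose).det =
      2 ^ J * ∏ k, blockDisc a b c d k := by
  let e₁ : Fin I ⊕ Fin I ≃ Fin 2 × Fin I :=
    { toFun := Sum.elim (fun i => (0, i)) (fun i => (1, i))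
      invFun := fun p => if p.1 = 0 then .inl p.2 else .inr p.2
      left_inv := by rintro (i | i) <;> simp
      right_inv := by rintro ⟨i, j⟩; fin_cases i <;> simp }
  let N : Matrix (Fin I ⊕ Fin I) (Fin I ⊕ Fin I) S :=
    (Matrix.blockDiagonal fun i => !![2 * a i, b i; b i, 2 * c i]).submatrix e₁ e₁
  have h : blockMatrix a b c d + (blockMatrix a b c d).transpose =
      (Matrix.fromBlocks N 0 0 (Matrix.diagonal fun j => 2 * d j)).submatrix
        (Equiv.sumAssoc _ _ _).symm (Equiv.sumAssoc _ _ _).symm := by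
    ext (i | i | i) (j | j | j) <;>
      simp [blockMatrix, N, e₁, Matrix.blockDiagonal_apply, Matrix.diagonal_apply] <;>
      rcases eq_or_ne i j with hij | hij <;> first
        | (subst hij; simp [two_mul])
        | simp [hij, hij.symm]
  rw [h, Matrix.det_submatrix_equiv_self, Matrix.det_fromBlocks_zero₂₁,
    Matrix.det_submatrix_equiv_self, Matrix.det_blockDiagonal, Matrix.det_diagonal,
    Fintype.prod_sum_type, Finset.prod_mul_distrib]
  simp only [Matrix.det_fin_two_of, Finset.prod_const, Finset.card_univ, Fintype.card_fin,
    blockDisc, Sum.elim_inl, Sum.elim_inr]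
  have : ∀ i, 2 * a i * (2 * c i) - b i * b i = 4 * a i * c i - b i ^ 2 := fun i => by ring
  simp only [this]
  ring

lemma map_blockForm (ψ : S →+* T) :
    map ψ (blockForm a b c d) = blockForm (ψ ∘ a) (ψ ∘ b) (ψ ∘ c) (ψ ∘ d) := by
  simp [blockForm]

lemma map_blockDisc (ψ : S →+* T) (k : Fin I ⊕ Fin J) :
    ψ (blockDisc a b c d k) = blockDisc (ψ ∘ a) (ψ ∘ b) (ψ ∘ c) (ψ ∘ d) k := by
  rcases k with k | k <;> simp [blockDisc, map_ofNat]

lemma isHomogeneous_blockForm : (blockForm a b c d).IsHomogeneous 2 := by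
  rw [← quadPoly_blockMatrix]
  exact isHomogeneous_quadPoly _

lemma pderiv_blockForm_x (i : Fin I) : pderiv (.inl i) (blockForm a b c d) =
    C (2 * a i) * X (.inl i) + C (b i) * X (.inr (.inl i)) := by
  rw [← quadPoly_blockMatrix, pderiv_quadPoly]
  simp [blockMatrix, Matrix.diagonal_apply, apply_ite (C (R := S) (σ := _)), ite_mul, add_mul,
    Finset.sum_add_distrib, two_mul]
  ring

lemma pderiv_blockForm_y (i : Fin I) : pderiv (.inr (.inl i)) (blockForm a b c d) =
    C (b i) * X (.inl i) + C (2 * c i) * X (.inr (.inl i)) := by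
  rw [← quadPoly_blockMatrix, pderiv_quadPoly]
  simp [blockMatrix, Matrix.diagonal_apply, apply_ite (C (R := S) (σ := _)), ite_mul, add_mul,
    Finset.sum_add_distrib, two_mul]
  ring

lemma pderiv_blockForm_z (j : Fin J) : pderiv (.inr (.inr j)) (blockForm a b c d) =
    C (2 * d j) * X (.inr (.inr j)) := by
  rw [← quadPoly_blockMatrix, pderiv_quadPoly]
  simp [blockMatrix, Matrix.diagonal_apply, apply_ite (C (R := S) (σ := _)), ite_mul, add_mul,
    Finset.sum_add_distrib, two_mul]

/-- Over an algebraically closed field, a block form with a degenerate block is singular. -/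
lemma exists_isSingularAt_blockForm {K : Type*} [Field K] [IsAlgClosed K] {a b c : Fin I → K}
    {d : Fin J → K} {k : Fin I ⊕ Fin J} (hk : blockDisc a b c d k = 0) :
    ∃ w, w ≠ 0 ∧ IsSingularAt (blockForm a b c d) w := by
  rcases k with i | j
  · replace hk : 4 * a i * c i - b i ^ 2 = 0 := hk
    obtain ⟨x, y, hxy, h0, h1, h2⟩ : ∃ x y : K, (x ≠ 0 ∨ y ≠ 0) ∧
        a i * x ^ 2 + b i * x * y + c i * y ^ 2 = 0 ∧ 2 * a i * x + b i * y = 0 ∧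
        b i * x + 2 * c i * y = 0 := by
      by_cases ha : a i = 0
      · have hb : b i = 0 := by simpa [ha] using hk
        exact ⟨1, 0, by simp, by simp [ha], by simp [ha], by simp [hb]⟩
      · obtain ⟨x, hx⟩ := IsAlgClosed.exists_root
          (Polynomial.C (a i) * Polynomial.X ^ 2 + Polynomial.C (b i) * Polynomial.X +
            Polynomial.C (c i)) (by rw [Polynomial.degree_quadratic ha]; norm_num)
        have hx' : a i * x ^ 2 + b i * x + c i = 0 := by simpa [Polynomial.IsRoot] using hx
        -- The square of the derivative at a root is minus the block discriminant, so the root is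
        -- double. This also holds in characteristic 2.
        have h1 : 2 * a i * x + b i = 0 := by
          apply pow_eq_zero_iff two_ne_zero |>.mp
          linear_combination 4 * a i * hx' - hk
        exact ⟨x, 1, by simp, by linear_combination hx', by linear_combination h1,
          by linear_combination 2 * hx' - x * h1⟩
    refine ⟨Sum.elim (Pi.single i x) (Sum.elim (Pi.single i y) 0), ?_, ?_, ?_⟩
    · intro h
      have e1 := congrFun h (.inl i)
      have e2 := congrFun h (.inr (.inl i))
      simp at e1 e2
      rcases hxy with h | h
      · exact h e1
      · exact h e2
    · simp only [blockForm, map_add, map_sum, map_mul, eval_C, eval_X, map_pow, Sum.elim_inl,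
        Sum.elim_inr]
      rw [Finset.sum_eq_single i]
      · simpa using h0
      · intro l _ hl
        simp [hl]
      · simp
    · rintro (l | l | l)
      · rw [pderiv_blockForm_x]
        by_cases hl : l = i
        · subst hl; simpa using h1
        · simp [hl]
      · rw [pderiv_blockForm_y]
        by_cases hl : l = i
        · subst hl; simpa using h2
        · simp [hl]
      · simp [pderiv_blockForm_z]
  · replace hk : d j = 0 := hk
    refine ⟨Sum.elim 0 (Sum.elim 0 (Pi.single j 1)), ?_, ?_, ?_⟩
    · intro h
      simpa using congrFun h (.inr (.inr j))
    · simp only [blockForm, map_add, map_sum, map_mul, eval_C, eval_X, map_pow, Sum.elim_inl,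
        Sum.elim_inr]
      rw [Finset.sum_eq_single (s := Finset.univ (α := Fin J)) j]
      · simp [hk]
      · intro l _ hl
        simp [hl]
      · simp
    · rintro (l | l | l)
      · simp [pderiv_blockForm_x]
      · simp [pderiv_blockForm_y]
      · rw [pderiv_blockForm_z]
        by_cases hl : l = j
        · subst hl; simp [hk]
        · simp [hl]

lemma IsSingularAt.rename {σ τ : Type*} {f : MvPolynomial σ S} {x : σ → S}
    (h : IsSingularAt f x) (e : σ ≃ τ) : IsSingularAt (MvPolynomial.rename e f) (x ∘ e.symm) := by
  refine ⟨?_, fun i => ?_⟩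
  · rw [eval_rename, Function.comp_assoc, e.symm_comp_self]
    exact h.1
  · obtain ⟨i, rfl⟩ := e.surjective i
    rw [pderiv_rename e.injective, eval_rename, Function.comp_assoc, e.symm_comp_self]
    exact h.2 i

end BlockMatrix

/-! ### The half-determinant in odd size -/

section OddDeterminant

variable {S σ : Type*} [CommRing S] [Fintype σ] [DecidableEq σ]

/-- Transposition gives only det = -det, which suffices for the generic matrix over ℤ; the identity
is then specialized, so 2 may be a zero divisor in `S`. -/
lemma det_sub_transpose_eq_zero (hσ : Odd (Fintype.card σ)) (U : Matrix σ σ S) :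
    (U - U.transpose).det = 0 := by
  let V := Matrix.mvPolynomialX σ σ ℤ
  have hV : (V - V.transpose).det = 0 := by
    have h : (V - V.transpose).det = -(V - V.transpose).det := by
      conv_lhs => rw [← Matrix.det_transpose, Matrix.transpose_sub, Matrix.transpose_transpose,
        ← neg_sub, Matrix.det_neg, hσ.neg_one_pow, neg_one_mul]
    exact self_eq_neg.mp h
  let ψ : MvPolynomial (σ × σ) ℤ →+* S := eval₂Hom (Int.castRingHom S) fun p => U p.1 p.2
  have hU : V.map ψ = U := by
    ext i j
    simp [V, ψ]
  have := congrArg ψ hV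
  rw [map_zero, RingHom.map_det, RingHom.mapMatrix_apply, Matrix.map_sub _ (map_sub ψ),
    Matrix.transpose_map, hU] at this
  exact this

/-- A symmetric matrix of odd size with even diagonal has even determinant. -/
lemma two_dvd_det_add_transpose (hσ : Odd (Fintype.card σ)) (U : Matrix σ σ S) :
    2 ∣ (U + U.transpose).det := by
  -- Modulo 2 the matrices U + Uᵀ and U - Uᵀ agree.
  rw [← Ideal.mem_span_singleton, ← Ideal.Quotient.eq_zero_iff_mem, RingHom.map_det,
    RingHom.mapMatrix_apply, ← det_sub_transpose_eq_zero hσ (U.map (Ideal.Quotient.mk _))]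
  congr 1
  ext i j
  have h2 : (Ideal.Quotient.mk (Ideal.span {(2 : S)})) 2 = 0 :=
    Ideal.Quotient.eq_zero_iff_mem.mpr (Ideal.mem_span_singleton_self 2)
  have h3 := congrArg (Ideal.Quotient.mk (Ideal.span {(2 : S)}) (U j i) * ·) h2
  simp only [map_ofNat, mul_zero] at h3
  simp only [Matrix.map_apply, Matrix.add_apply, Matrix.sub_apply, Matrix.transpose_apply, map_add]
  linear_combination h3

/-- The half-discriminant lies in the ideal of the discriminant. -/
lemma exists_half_det_mem {n I J : ℕ} (hJ : J ≤ 1) (hIJ : 2 * I + J = n + 1) :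
    ∃ Q ∈ discriminantIdeal n, 2 ^ J * Q = (genericHessian n).det := by
  rcases Nat.le_one_iff_eq_zero_or_eq_one.mp hJ with rfl | rfl
  · exact ⟨_, det_genericHessian_mem, by simp⟩
  · obtain ⟨Q, hQ⟩ := two_dvd_det_add_transpose (by rw [Fintype.card_fin]; exact ⟨I, hIJ.symm⟩)
      (genericMatrix n)
    have h := det_genericHessian_mem (n := n)
    rw [genericHessian, hQ] at h
    -- The ideal is prime and does not contain 2, so the factor 2 can be removed.
    refine ⟨Q, ((isPrime_discriminantIdeal n).mem_or_mem h).resolve_left ?_, ?_⟩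
    · have := intCast_notMem_discriminantIdeal (n := n) (two_ne_zero (α := ℤ))
      simpa using this
    · rw [genericHessian, hQ, pow_one]

end OddDeterminant

/-! ### Divisibility between the discriminant and the block discriminants -/

section GenericBlock

variable {n I J : ℕ}

/-- The ring of coefficients of a generic block form and a generic linear change of variables. -/
abbrev BlockRing (n I J : ℕ) : Type :=
  MvPolynomial ((Fin I ⊕ Fin I ⊕ Fin I ⊕ Fin J) ⊕ (Fin (n + 1) × Fin (n + 1))) ℤ

/-- The generic coefficients of `x_i²`. -/
def blockA (i : Fin I) : BlockRing n I J := X (.inl (.inl i))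

/-- The generic coefficients of `x_i y_i`. -/
def blockB (i : Fin I) : BlockRing n I J := X (.inl (.inr (.inl i)))

/-- The generic coefficients of `y_i²`. -/
def blockC (i : Fin I) : BlockRing n I J := X (.inl (.inr (.inr (.inl i))))

/-- The generic coefficients of `z_j²`. -/
def blockD (j : Fin J) : BlockRing n I J := X (.inl (.inr (.inr (.inr j))))

/-- The generic change of variables. -/
def blockSubst (n I J : ℕ) : Matrix (Fin (n + 1)) (Fin (n + 1)) (BlockRing n I J) :=
  Matrix.of fun i j => X (.inr (i, j))

/-- The image of the generic block form under the generic change of variables. -/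
def genericBlockForm (e : Fin I ⊕ Fin I ⊕ Fin J ≃ Fin (n + 1)) :
    MvPolynomial (Fin (n + 1)) (BlockRing n I J) :=
  subst (blockSubst n I J) (rename e (blockForm blockA blockB blockC blockD))

/-- The discriminants of the blocks of the generic block form. -/
def genericBlockDisc (n : ℕ) : Fin I ⊕ Fin J → BlockRing n I J :=
  blockDisc blockA blockB blockC blockD

lemma isHomogeneous_rename_blockForm {S : Type*} [CommRing S] (e : Fin I ⊕ Fin I ⊕ Fin J ≃ Fin (n + 1))
    (a b c : Fin I → S) (d : Fin J → S) : (rename e (blockForm a b c d)).IsHomogeneous 2 :=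
  (isHomogeneous_blockForm a b c d).rename_isHomogeneous

variable {R : Type*} [CommRing R] (a b c : Fin I → R) (d : Fin J → R)
  (B : Matrix (Fin (n + 1)) (Fin (n + 1)) R)

/-- Specialization of the generic block form. -/
def specialize : BlockRing n I J →+* R :=
  eval₂Hom (Int.castRingHom R)
    (Sum.elim (Sum.elim a (Sum.elim b (Sum.elim c d))) fun p => B p.1 p.2)

lemma map_blockSubst : (blockSubst n I J).map (specialize a b c d B) = B := by
  ext i j
  simp [blockSubst, specialize]

lemma specialize_comp_blockA : specialize a b c d B ∘ blockA = a := by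
  funext i
  simp [specialize, blockA]

lemma specialize_comp_blockB : specialize a b c d B ∘ blockB = b := by
  funext i
  simp [specialize, blockB]

lemma specialize_comp_blockC : specialize a b c d B ∘ blockC = c := by
  funext i
  simp [specialize, blockC]

lemma specialize_comp_blockD : specialize a b c d B ∘ blockD = d := by
  funext i
  simp [specialize, blockD]

lemma map_genericBlockDisc (k : Fin I ⊕ Fin J) :
    specialize a b c d B (genericBlockDisc n k) = blockDisc a b c d k := by
  rw [genericBlockDisc, map_blockDisc, specialize_comp_blockA, specialize_comp_blockB,
    specialize_comp_blockC, specialize_comp_blockD]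

lemma map_genericBlockForm (e : Fin I ⊕ Fin I ⊕ Fin J ≃ Fin (n + 1)) :
    map (specialize a b c d B) (genericBlockForm e) = subst B (rename e (blockForm a b c d)) := by
  rw [genericBlockForm, map_subst, map_blockSubst, map_rename, map_blockForm,
    specialize_comp_blockA, specialize_comp_blockB, specialize_comp_blockC,
    specialize_comp_blockD]

/-- 4ac - b² is linear in c with coprime coefficients 4a and -b², and d is a variable. -/
lemma irreducible_genericBlockDisc (k : Fin I ⊕ Fin J) :
    Irreducible (genericBlockDisc n k : BlockRing n I J) := by
  classical
  rcases k with i | j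
  · have h : (genericBlockDisc n (.inl i) : BlockRing n I J) =
        C 4 * blockA i * X (.inl (.inr (.inr (.inl i)))) + -(blockB i ^ 2) := by
      rw [← sub_eq_add_neg, map_ofNat]
      rfl
    rw [h]
    apply irreducible_mul_X_add
    · exact mul_ne_zero (by simp) (X_ne_zero _)
    · intro hm
      have := vars_mul _ _ hm
      rw [vars_C, Finset.empty_union] at this
      simp [blockA] at this
    · rw [vars_neg]
      intro hm
      have := vars_pow _ _ hm
      simp [blockB] at this
    · rw [IsRelPrime.neg_right_iff]
      refine IsRelPrime.pow_right ?_
      refine ((X_prime (R := ℤ)).irreducible.isRelPrime_iff_not_dvd.mpr ?_).symm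
      rintro ⟨q, hq⟩
      have := congrArg (specialize (1 : Fin I → ℤ) 0 0 (0 : Fin J → ℤ) 0) hq
      simp [specialize, blockA] at this
  · exact (X_prime (R := ℤ)).irreducible

/-- Irreducibles that do not divide one another: setting a = c = 1 or d = 1 in block l and all else
to 0 kills the k-th discriminant and leaves 4 or 1 for the l-th. -/
lemma isRelPrime_genericBlockDisc :
    Pairwise (Function.onFun IsRelPrime (genericBlockDisc n : Fin I ⊕ Fin J → BlockRing n I J)) := by
  classical
  intro k l hkl
  refine (irreducible_genericBlockDisc k).isRelPrime_iff_not_dvd.mpr ?_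
  rintro ⟨q, hq⟩
  let a : Fin I → ℤ := fun i => if .inl i = l then 1 else 0
  let d : Fin J → ℤ := fun j => if .inr j = l then 1 else 0
  have := congrArg (specialize a 0 a d 0) hq
  rw [map_mul, map_genericBlockDisc, map_genericBlockDisc] at this
  have hk : blockDisc a 0 a d k = 0 := by
    rcases k with k | k <;> simp [blockDisc, a, d, hkl]
  have hl : blockDisc a 0 a d l ≠ 0 := by
    rcases l with l | l <;> simp [blockDisc, a, d]
  exact hl (by rw [this, hk, zero_mul])

/-- Over an algebraic closure of the residue field at the prime (p), where p is the k-th block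
discriminant, the k-th block degenerates and the form becomes singular. So the value of `G` vanishes
there, which means that p divides it. -/
lemma genericBlockDisc_dvd (e : Fin I ⊕ Fin I ⊕ Fin J ≃ Fin (n + 1)) {G : CoeffRing n 2}
    (hG : G ∈ discriminantIdeal n) (k : Fin I ⊕ Fin J) :
    genericBlockDisc n k ∣ evalAtForm G (genericBlockForm e) := by
  let p : BlockRing n I J := genericBlockDisc n k
  have hp : Prime p := (irreducible_genericBlockDisc k).prime
  let P : Ideal (BlockRing n I J) := Ideal.span {p}
  have hP : P.IsPrime := (Ideal.span_singleton_prime hp.ne_zero).mpr hp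
  let K := AlgebraicClosure (FractionRing (BlockRing n I J ⧸ P))
  let ψ : BlockRing n I J →+* K :=
    ((algebraMap (FractionRing (BlockRing n I J ⧸ P)) K).comp (algebraMap _ _)).comp
      (Ideal.Quotient.mk P)
  have hψ : ∀ x, ψ x = 0 ↔ p ∣ x := by
    intro x
    rw [← Ideal.mem_span_singleton, ← Ideal.Quotient.eq_zero_iff_mem]
    exact map_eq_zero_iff ((algebraMap (FractionRing (BlockRing n I J ⧸ P)) K).comp
      (algebraMap (BlockRing n I J ⧸ P) _))
      ((algebraMap (FractionRing (BlockRing n I J ⧸ P)) K).injective.comp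
        (IsFractionRing.injective _ _))
  have hdet : ((blockSubst n I J).map ψ).det ≠ 0 := by
    intro h
    have h1 : ψ (blockSubst n I J).det = 0 := by rw [RingHom.map_det]; exact h
    obtain ⟨q, hq⟩ := (hψ _).mp h1
    -- Identity substitution and zero coefficients: the block discriminant becomes 0 and the
    -- determinant 1, so p does not divide the determinant.
    have := congrArg (specialize (0 : Fin I → ℤ) 0 0 (0 : Fin J → ℤ) 1) hq
    rw [map_mul, map_genericBlockDisc, RingHom.map_det, RingHom.mapMatrix_apply, map_blockSubst,
      Matrix.det_one] at this
    rcases k with k | k <;> simp [blockDisc] at this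
  obtain ⟨w, hw, hsing⟩ := exists_isSingularAt_blockForm (K := K) (k := k)
    (by rw [← map_blockDisc _ _ _ _ ψ]; exact (hψ _).mpr dvd_rfl)
  let B := (blockSubst n I J).map ψ
  have hBx : B.mulVec (B⁻¹.mulVec (w ∘ e.symm)) = (1 : K) • (w ∘ e.symm) := by
    rw [Matrix.mulVec_mulVec, Matrix.mul_nonsing_inv _ hdet.isUnit, Matrix.one_mulVec, one_smul]
  rw [← hψ, map_evalAtForm, genericBlockForm, map_subst, map_rename, map_blockForm]
  refine evalAtForm_eq_zero hG (isHomogeneous_subst _ (isHomogeneous_rename_blockForm e _ _ _ _))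
    (x := B⁻¹.mulVec (w ∘ e.symm)) ?_
    ((hsing.rename e).subst (isHomogeneous_rename_blockForm e _ _ _ _) hBx)
  intro h
  rw [h, Matrix.mulVec_zero, one_smul] at hBx
  exact hw (funext fun i => by simpa using (congrFun hBx (e i)).symm)

/-- The discriminant of a form equivalent to a block form is divisible by the product of the
discriminants of the blocks. -/
theorem prod_blockDisc_dvd (e : Fin I ⊕ Fin I ⊕ Fin J ≃ Fin (n + 1)) {G : CoeffRing n 2}
    (hG : G ∈ discriminantIdeal n) :
    ∏ k, blockDisc a b c d k ∣ evalAtForm G (subst B (rename e (blockForm a b c d))) := by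
  -- Coprimality of the blocks is available only for generic coefficients, so the product is formed
  -- there and then specialized.
  have h := map_dvd (specialize a b c d B) (Fintype.prod_dvd_of_isRelPrime
    isRelPrime_genericBlockDisc (genericBlockDisc_dvd e hG))
  rw [map_evalAtForm, map_genericBlockForm, map_prod] at h
  simpa only [map_genericBlockDisc] using h

/-- The factor 2^J is cancelled in the generic ring, which has characteristic zero; specialization
then covers rings where 2 = 0. -/
lemma evalAtForm_half_det (e : Fin I ⊕ Fin I ⊕ Fin J ≃ Fin (n + 1)) {Q : CoeffRing n 2}
    (hQ : 2 ^ J * Q = (genericHessian n).det) :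
    evalAtForm Q (subst B (rename e (blockForm a b c d))) =
      B.det ^ 2 * ∏ k, blockDisc a b c d k := by
  have h : evalAtForm Q (genericBlockForm e) =
      (blockSubst n I J).det ^ 2 * ∏ k, genericBlockDisc n k := by
    have h2 : (2 : BlockRing n I J) ^ J ≠ 0 := pow_ne_zero _ two_ne_zero
    apply mul_left_cancel₀ h2
    have h3 : (2 : BlockRing n I J) ^ J * evalAtForm Q (genericBlockForm e) =
        evalAtForm (genericHessian n).det (genericBlockForm e) := by
      rw [← hQ]
      simp [evalAtForm]
    rw [h3, genericBlockForm, ← quadPoly_blockMatrix, rename_quadPoly, subst_quadPoly,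
      evalAtForm_det_genericHessian]
    set M := blockMatrix (S := BlockRing n I J) blockA blockB blockC blockD with hM
    set U := blockSubst n I J
    have h4 : U.transpose * M.submatrix e.symm e.symm * U +
        (U.transpose * M.submatrix e.symm e.symm * U).transpose =
        U.transpose * ((M + M.transpose).submatrix e.symm e.symm) * U := by
      rw [Matrix.submatrix_add]
      simp [Matrix.mul_add, Matrix.add_mul, Matrix.mul_assoc]
    rw [h4, Matrix.det_mul, Matrix.det_mul, Matrix.det_submatrix_equiv_self, Matrix.det_transpose,
      hM, det_blockMatrix_add_transpose, genericBlockDisc]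
    ring
  have h5 := congrArg (specialize a b c d B) h
  rw [map_evalAtForm, map_genericBlockForm, map_mul, map_pow, RingHom.map_det,
    RingHom.mapMatrix_apply, map_blockSubst, map_prod] at h5
  simpa only [map_genericBlockDisc] using h5

end GenericBlock

/-! ### Smooth reduction -/

section Smooth

variable {R : Type*} [CommRing R] [IsLocalRing R] {n I J : ℕ}

/-- A block discriminant that is not a unit vanishes in the residue field, giving a singular vector
over its algebraic closure and hence a point of the singular locus over the residue field itself. -/
lemma isUnit_blockDisc_of_isSmoothHypersurface {a b c : Fin I → R} {d : Fin J → R}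
    {e : Fin I ⊕ Fin I ⊕ Fin J ≃ Fin (n + 1)} {A B : Matrix (Fin (n + 1)) (Fin (n + 1)) R}
    (hBA : B * A = 1)
    (h : IsSmoothHypersurface (map (IsLocalRing.residue R)
      (subst B (rename e (blockForm a b c d))))) (k : Fin I ⊕ Fin J) :
    IsUnit (blockDisc a b c d k) := by
  by_contra hk
  let K := AlgebraicClosure (IsLocalRing.ResidueField R)
  let φ := algebraMap (IsLocalRing.ResidueField R) K
  let ψ : R →+* K := φ.comp (IsLocalRing.residue R)
  have hk0 : ψ (blockDisc a b c d k) = 0 := by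
    rw [RingHom.comp_apply, (IsLocalRing.residue_eq_zero_iff _).mpr
      ((IsLocalRing.mem_maximalIdeal _).mpr hk), map_zero]
  rw [map_blockDisc] at hk0
  obtain ⟨w, hw, hsing⟩ := exists_isSingularAt_blockForm hk0
  have hmap : ∀ {U V : Matrix (Fin (n + 1)) (Fin (n + 1)) R}, U * V = 1 →
      U.map ψ * V.map ψ = 1 := fun hUV => by
    rw [← Matrix.map_mul, hUV, Matrix.map_one _ (map_zero ψ) (map_one ψ)]
  have hBx : (B.map ψ).mulVec ((A.map ψ).mulVec (w ∘ e.symm)) = (1 : K) • (w ∘ e.symm) := by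
    rw [Matrix.mulVec_mulVec, hmap hBA, Matrix.one_mulVec, one_smul]
  have hhom := isHomogeneous_rename_blockForm e a b c d
  obtain ⟨P, hP, -⟩ := exists_mem_singularLocus ((isHomogeneous_subst B hhom).map _) φ
    (x := (A.map ψ).mulVec (w ∘ e.symm)) (by
      intro h
      rw [h, Matrix.mulVec_zero, one_smul] at hBx
      exact hw (funext fun i => by simpa using (congrFun hBx (e i)).symm)) (by
      rw [map_map, map_subst]
      refine IsSingularAt.subst (hhom.map _) ?_ hBx
      rw [map_rename, map_blockForm]
      exact hsing.rename e)
  rw [IsSmoothHypersurface] at h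
  rw [h] at hP
  exact hP

end Smooth

/-! ### Dimension of a projective closed set and of its cone -/

section Dimension

variable {k : Type*} [Field k] {n : ℕ}

/-- A homogeneous prime over a field is contained in the irrelevant ideal. -/
lemma constantCoeff_eq_zero_of_mem (P : ProjSpace k n) {g : MvPolynomial (Fin (n + 1)) k}
    (hg : g ∈ P.asHomogeneousIdeal) : constantCoeff g = 0 := by
  have h0 : homogeneousComponent 0 g ∈ P.asHomogeneousIdeal := by
    rw [← decomposition.decompose'_apply]
    exact P.asHomogeneousIdeal.isHomogeneous 0 hg
  rw [homogeneousComponent_zero] at h0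
  by_contra h
  exact P.isPrime.ne_top (Ideal.eq_top_of_isUnit_mem _ h0 ((isUnit_iff_ne_zero.mpr h).map C))

lemma exists_constantCoeff_eq_zero_notMem (P : ProjSpace k n) :
    ∃ g, constantCoeff g = 0 ∧ g ∉ P.asHomogeneousIdeal := by
  by_contra! h
  refine P.not_irrelevant_le fun g hg => h g ?_
  rw [HomogeneousIdeal.mem_irrelevant_iff, GradedRing.proj_apply] at hg
  have : homogeneousComponent 0 g = 0 := by rwa [← decomposition.decompose'_apply]
  rwa [homogeneousComponent_zero, C_eq_zero] at this

lemma isPrime_vanishingIdeal {W : Set (ProjSpace k n)} (hW : IsIrreducible W) :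
    (ProjectiveSpectrum.vanishingIdeal W).toIdeal.IsPrime := by
  constructor
  · obtain ⟨P, hP⟩ := hW.nonempty
    intro h
    refine P.isPrime.ne_top (top_le_iff.mp ?_)
    rw [← h]
    intro g hg
    exact (ProjectiveSpectrum.mem_vanishingIdeal W g).mp hg P hP
  · intro x y hxy
    have hle : W ⊆ ProjectiveSpectrum.zeroLocus _ {x} ∪ ProjectiveSpectrum.zeroLocus _ {y} := by
      intro P hP
      have h := (ProjectiveSpectrum.mem_vanishingIdeal W _).mp hxy P hP
      simpa using P.isPrime.mem_or_mem h
    rcases isPreirreducible_iff_isClosed_union_isClosed.mp hW.isPreirreducible _ _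
      (ProjectiveSpectrum.isClosed_zeroLocus _ _) (ProjectiveSpectrum.isClosed_zeroLocus _ _) hle
      with h | h
    · left
      exact (ProjectiveSpectrum.mem_vanishingIdeal W x).mpr fun P hP => by simpa using h hP
    · right
      exact (ProjectiveSpectrum.mem_vanishingIdeal W y).mpr fun P hP => by simpa using h hP

/-- The dimension of a closed subset of projective space is less than that of its cone. -/
theorem topologicalKrullDim_zeroLocus_add_one_le (s : Set (MvPolynomial (Fin (n + 1)) k))
    (hs : (ProjectiveSpectrum.zeroLocus (homogeneousSubmodule (Fin (n + 1)) k) s).Nonempty) :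
    topologicalKrullDim (ProjectiveSpectrum.zeroLocus (homogeneousSubmodule (Fin (n + 1)) k) s) + 1
      ≤ ringKrullDim (MvPolynomial (Fin (n + 1)) k ⧸ Ideal.span s) := by
  let Z := ProjectiveSpectrum.zeroLocus (homogeneousSubmodule (Fin (n + 1)) k) s
  have hZ : IsClosed Z := ProjectiveSpectrum.isClosed_zeroLocus _ _
  obtain ⟨P₀, hP₀⟩ := hs
  have hne : Nonempty (TopologicalSpace.IrreducibleCloseds Z) :=
    ⟨⟨closure {⟨P₀, hP₀⟩}, isIrreducible_singleton.closure, isClosed_closure⟩⟩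
  let img (Y : TopologicalSpace.IrreducibleCloseds Z) : Set (ProjSpace k n) :=
    Subtype.val '' (Y : Set Z)
  have himg : ∀ Y, IsIrreducible (img Y) := fun Y =>
    Y.isIrreducible'.image _ continuous_subtype_val.continuousOn
  have hcl : ∀ Y, IsClosed (img Y) := fun Y => hZ.isClosedMap_subtype_val _ Y.isClosed'
  have hirr : (RingHom.ker (constantCoeff : MvPolynomial (Fin (n + 1)) k →+* k)).IsPrime :=
    RingHom.ker_isPrime _
  -- Irreducible closed sets correspond to primes of the cone, with inclusion reversed. The added
  -- bottom element goes to the irrelevant ideal, strictly above all of these; this is the extra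
  -- dimension.
  let toPrime : WithBot (TopologicalSpace.IrreducibleCloseds Z) →
      (PrimeSpectrum.zeroLocus (Ideal.span s : Set (MvPolynomial (Fin (n + 1)) k)))ᵒᵈ :=
    WithBot.recBotCoe
      (OrderDual.toDual ⟨⟨RingHom.ker constantCoeff, hirr⟩, by
        rw [PrimeSpectrum.mem_zeroLocus, SetLike.coe_subset_coe, Ideal.span_le]
        exact fun g hg => constantCoeff_eq_zero_of_mem P₀ (hP₀ hg)⟩)
      (fun Y => OrderDual.toDual ⟨⟨(ProjectiveSpectrum.vanishingIdeal (img Y)).toIdeal,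
        isPrime_vanishingIdeal (himg Y)⟩, by
        rw [PrimeSpectrum.mem_zeroLocus, SetLike.coe_subset_coe, Ideal.span_le]
        intro g hg
        refine (ProjectiveSpectrum.mem_vanishingIdeal _ g).mpr ?_
        rintro _ ⟨P, -, rfl⟩
        exact P.2 hg⟩)
  have hmono : StrictMono toPrime := by
    intro Y₁ Y₂ h
    induction Y₂ using WithBot.recBotCoe with
    | bot => exact absurd h not_lt_bot
    | coe Y₂ =>
      induction Y₁ using WithBot.recBotCoe with
      | bot =>
        obtain ⟨P, hP⟩ := (himg Y₂).nonempty
        change (ProjectiveSpectrum.vanishingIdeal (img Y₂)).toIdeal < RingHom.ker constantCoeff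
        have hle : (ProjectiveSpectrum.vanishingIdeal (img Y₂)).toIdeal ≤
            P.asHomogeneousIdeal.toIdeal := fun g hg =>
          (ProjectiveSpectrum.mem_vanishingIdeal _ g).mp hg P hP
        obtain ⟨g, hg, hgP⟩ := exists_constantCoeff_eq_zero_notMem P
        exact SetLike.lt_iff_le_and_exists.mpr
          ⟨fun g hg => constantCoeff_eq_zero_of_mem P (hle hg), g, hg, fun h => hgP (hle h)⟩
      | coe Y₁ =>
        have h' : Y₁ < Y₂ := WithBot.coe_lt_coe.mp h
        change (ProjectiveSpectrum.vanishingIdeal (img Y₂)).toIdeal <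
          (ProjectiveSpectrum.vanishingIdeal (img Y₁)).toIdeal
        have hsub : img Y₁ ⊆ img Y₂ := Set.image_mono h'.le
        refine lt_of_le_of_ne 
          (ProjectiveSpectrum.vanishingIdeal_anti_mono _ hsub) fun heq => ?_
        have h1 := ProjectiveSpectrum.zeroLocus_vanishingIdeal_eq_closure _ (img Y₁)
        have h2 := ProjectiveSpectrum.zeroLocus_vanishingIdeal_eq_closure _ (img Y₂)
        have h3 : ProjectiveSpectrum.vanishingIdeal (img Y₂) =
            ProjectiveSpectrum.vanishingIdeal (img Y₁) := HomogeneousIdeal.toIdeal_injective heq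
        rw [← h3, h2, (hcl Y₁).closure_eq, (hcl Y₂).closure_eq] at h1
        exact h'.not_ge ((Set.image_subset_image_iff Subtype.val_injective).mp h1.le)
  have h := Order.krullDim_le_of_strictMono toPrime hmono
  rw [Order.krullDim_withBot, Order.krullDim_orderDual] at h
  rw [ringKrullDim, Order.krullDim_eq_of_orderIso (Ideal.span s).primeSpectrumQuotientOrderIsoZeroLocus]
  exact h

/-- By incomparability, contraction of primes along an integral map is strictly monotone. -/
lemma ringKrullDim_le_of_isIntegral {A B : Type*} [CommRing A] [CommRing B] {f : A →+* B}
    (hf : f.IsIntegral) : ringKrullDim B ≤ ringKrullDim A := by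
  let := f.toAlgebra
  have : Algebra.IsIntegral A B := ⟨hf⟩
  exact Order.krullDim_le_of_strictMono (PrimeSpectrum.comap (algebraMap A B)) fun P Q h =>
    Ideal.IsIntegral.comap_lt_comap (show P.asIdeal < Q.asIdeal from h)

/-- If the elements `y v` generate `T` and are integral over those with `v ∈ V`, then the dimension
of `T` is at most the cardinality of `V`. -/
lemma ringKrullDim_le_card {T : Type*} [CommRing T] [Algebra k T] {σ : Type*} (V : Finset σ)
    (y : σ → T) (hgen : Algebra.adjoin k (Set.range y) = ⊤)
    (hint : ∀ C₀ : Subalgebra k T, (∀ x n, 0 < n → x ^ n ∈ C₀ → x ∈ C₀) → (∀ v ∈ V, y v ∈ C₀) →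
      ∀ v, y v ∈ C₀) : ringKrullDim T ≤ (V.card : ℕ) := by
  let φ : MvPolynomial V k →ₐ[k] T := aeval fun v => y v
  -- The elements integral over the image of k[V]. This algebra is closed under extraction of roots,
  -- as `hint` requires.
  let C₀ : Subalgebra k T :=
    { carrier := {x | φ.toRingHom.IsIntegralElem x}
      mul_mem' := fun hx hy => hx.mul _ hy
      add_mem' := fun hx hy => hx.add _ hy
      algebraMap_mem' := fun r => by
        have : algebraMap k T r = φ.toRingHom (C r) := (φ.commutes r).symm
        rw [this]
        exact RingHom.isIntegralElem_map _ }
  have hC₀ : ∀ v, y v ∈ C₀ := by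
    refine hint C₀ (fun x n hn hx => ?_) fun v hv => ?_
    · let := φ.toRingHom.toAlgebra
      exact IsIntegral.of_pow hn (R := MvPolynomial V k) hx
    · have : y v = φ.toRingHom (X ⟨v, hv⟩) :=
        (aeval_X (fun v : V => y v) (⟨v, hv⟩ : V)).symm
      rw [this]
      exact RingHom.isIntegralElem_map _
  have htop : C₀ = ⊤ := top_le_iff.mp (hgen ▸ Algebra.adjoin_le (Set.range_subset_iff.mpr hC₀))
  have hφ : φ.toRingHom.IsIntegral := fun x => by
    have : x ∈ C₀ := htop ▸ Algebra.mem_top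
    exact this
  refine (ringKrullDim_le_of_isIntegral hφ).trans ?_
  rw [MvPolynomial.ringKrullDim_of_isNoetherianRing, ringKrullDim_eq_zero_of_field]
  simp

end Dimension

/-! ### Valuation of a block discriminant against its free coordinates -/

section Valuation

open IsDiscreteValuationRing IsLocalRing

variable {R : Type*} [CommRing R] [IsDomain R] [IsDiscreteValuationRing R]

lemma one_le_addVal {x : R} (hx : ¬ IsUnit x) : 1 ≤ addVal R x := by
  rw [Order.one_le_iff_ne_zero]
  exact fun h => hx (addVal_eq_zero_iff.mp h)

lemma two_le_addVal_mul_sub {x y z : R} (hx : ¬ IsUnit x) (hy : ¬ IsUnit y) (hz : ¬ IsUnit z) :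
    2 ≤ addVal R (x * z - y ^ 2) := by
  obtain ⟨ϖ, hϖ⟩ := exists_irreducible R
  have hdvd : ∀ {u : R}, ¬ IsUnit u → ϖ ∣ u := by
    intro u hu
    rw [← addVal_le_iff_dvd, addVal_uniformizer hϖ]
    exact one_le_addVal hu
  have h : addVal R (ϖ ^ 2) = 2 := by simp [addVal_uniformizer hϖ]
  rw [← h, addVal_le_iff_dvd, pow_two]
  exact dvd_sub (mul_dvd_mul (hdvd hx) (hdvd hz)) (pow_two y ▸ mul_dvd_mul (hdvd hy) (hdvd hy))

/-- The variables of a block of size two are determined, up to linear relations, by at most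
as many of them as the valuation of the discriminant of the block. -/
lemma exists_block_parameters (a b c : R) {T : Type*} [CommRing T] [Algebra (ResidueField R) T]
    {x y : T}
    (h₁ : residue R (2 * a) • x + residue R b • y = 0)
    (h₂ : residue R b • x + residue R (2 * c) • y = 0) :
    ∃ p q : Bool, (p.toNat + q.toNat : ℕ) ≤ addVal R (4 * a * c - b ^ 2) ∧
      ∀ C₀ : Subalgebra (ResidueField R) T, (p → x ∈ C₀) → (q → y ∈ C₀) → x ∈ C₀ ∧ y ∈ C₀ := by
  have hsolve : ∀ {r s : ResidueField R} {u v : T} (C₀ : Subalgebra (ResidueField R) T), r ≠ 0 →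
      r • u + s • v = 0 → v ∈ C₀ → u ∈ C₀ := by
    intro r s u v C₀ hr h hv
    have : u = (-(r⁻¹ * s)) • v := by
      rw [neg_smul, mul_smul, ← smul_neg, eq_inv_smul_iff₀ hr]
      exact eq_neg_of_add_eq_zero_left h
    rw [this]
    exact C₀.smul_mem hv _
  by_cases hu : IsUnit (4 * a * c - b ^ 2)
  · have hdet : residue R (2 * a) * residue R (2 * c) - residue R b * residue R b ≠ 0 := by
      rw [← map_mul, ← map_mul, ← map_sub, residue_ne_zero_iff_isUnit]
      convert hu using 1
      ring
    -- With invertible determinant the linear system forces x = y = 0, so no parameter is needed.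
    refine ⟨false, false, by simp, fun C₀ _ _ => ?_⟩
    have hx : (residue R (2 * a) * residue R (2 * c) - residue R b * residue R b) • x = 0 := by
      have : (residue R (2 * a) * residue R (2 * c) - residue R b * residue R b) • x =
          residue R (2 * c) • (residue R (2 * a) • x + residue R b • y) -
            residue R b • (residue R b • x + residue R (2 * c) • y) := by
        simp only [Algebra.smul_def, map_sub, map_mul]
        ring
      rw [this, h₁, h₂, smul_zero, smul_zero, sub_zero]
    have hy : (residue R (2 * a) * residue R (2 * c) - residue R b * residue R b) • y = 0 := by
      have : (residue R (2 * a) * residue R (2 * c) - residue R b * residue R b) • y =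
          residue R (2 * a) • (residue R b • x + residue R (2 * c) • y) -
            residue R b • (residue R (2 * a) • x + residue R b • y) := by
        simp only [Algebra.smul_def, map_sub, map_mul]
        ring
      rw [this, h₁, h₂, smul_zero, smul_zero, sub_zero]
    rw [(smul_eq_zero_iff_right hdet).mp hx, (smul_eq_zero_iff_right hdet).mp hy]
    exact ⟨C₀.zero_mem, C₀.zero_mem⟩
  · have h1 := one_le_addVal hu
    by_cases ha : residue R (2 * a) = 0
    · by_cases hb : residue R b = 0
      · by_cases hc : residue R (2 * c) = 0
        · refine ⟨true, true, ?_, fun C₀ hx hy => ⟨hx rfl, hy rfl⟩⟩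
          have hn : ∀ {z : R}, residue R z = 0 → ¬ IsUnit z := fun hz h =>
            residue_ne_zero_iff_isUnit _ |>.mpr h hz
          have := two_le_addVal_mul_sub (hn ha) (hn hb) (hn hc)
          rw [show 4 * a * c - b ^ 2 = 2 * a * (2 * c) - b ^ 2 by ring]
          simpa using this
        · exact ⟨true, false, by simpa using h1, fun C₀ hx _ =>
            ⟨hx rfl, hsolve C₀ hc (by rwa [add_comm]) (hx rfl)⟩⟩
      · exact ⟨true, false, by simpa using h1, fun C₀ hx _ =>
          ⟨hx rfl, hsolve C₀ hb (by rwa [add_comm]) (hx rfl)⟩⟩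
    · exact ⟨false, true, by simpa using h1, fun C₀ _ hy =>
        ⟨hsolve C₀ ha h₁ (hy rfl), hy rfl⟩⟩

lemma addVal_prod {ι : Type*} (s : Finset ι) (f : ι → R) :
    addVal R (∏ i ∈ s, f i) = ∑ i ∈ s, addVal R (f i) := by
  classical
  induction s using Finset.induction_on with
  | empty => simp
  | insert i s hi ih => rw [Finset.prod_insert hi, Finset.sum_insert hi, addVal_mul, ih]

end Valuation

/-! ### The singular cone and the valuation of the discriminant -/

section SingularDimension

/-- The chain rule for a linear change of variables. -/
lemma pderiv_subst {S σ τ : Type*} [CommRing S] [Fintype σ] [Fintype τ] (A : Matrix σ τ S) (i : τ)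
    (f : MvPolynomial σ S) :
    pderiv i (subst A f) = ∑ j, C (A j i) * subst A (pderiv j f) := by
  classical
  induction f using MvPolynomial.induction_on with
  | C r => simp
  | add p q hp hq => simp [hp, hq, mul_add, Finset.sum_add_distrib]
  | mul_X p l hp =>
    have hl : pderiv i (subst A (X l)) = C (A l i) := by
      simp [subst_X, Pi.single_apply, pderiv_X]
    simp only [map_mul, Derivation.leibniz, smul_eq_mul, hl, hp, map_add, mul_add,
      Finset.sum_add_distrib, pderiv_X]
    congr 1
    · rw [Finset.sum_eq_single l]
      · simp [mul_comm]
      · intro j _ hj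
        simp [hj]
      · simp
    · rw [Finset.mul_sum]
      exact Finset.sum_congr rfl fun j _ => by ring

open IsDiscreteValuationRing IsLocalRing

variable {R : Type*} [CommRing R] [IsDomain R] [IsDiscreteValuationRing R] {n I J : ℕ}

/-- The coordinate ring of the singular cone is integral over the subalgebra generated by few block
coordinates. A rank-two block needs at most v(4ac - b²) of them by its linear equations, and z needs
one only if d is not a unit. -/
lemma ringKrullDim_singular_le (hJ : J ≤ 1) (a b c : Fin I → R) (d : Fin J → R)
    (e : Fin I ⊕ Fin I ⊕ Fin J ≃ Fin (n + 1)) {A B : Matrix (Fin (n + 1)) (Fin (n + 1)) R}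
    (hAB : A * B = 1) (hBA : B * A = 1) {f : MvPolynomial (Fin (n + 1)) (ResidueField R)}
    (hf : f = map (residue R) (subst B (rename e (blockForm a b c d)))) :
    ringKrullDim (MvPolynomial (Fin (n + 1)) (ResidueField R) ⧸
      Ideal.span (insert f (Set.range fun i => pderiv i f))) ≤
      ((addVal R (∏ k, blockDisc a b c d k) : ℕ∞) : WithBot ℕ∞) := by
  classical
  set s := insert f (Set.range fun i => pderiv i f)
  let T := MvPolynomial (Fin (n + 1)) (ResidueField R) ⧸ Ideal.span s
  let mk : MvPolynomial (Fin (n + 1)) (ResidueField R) →ₐ[ResidueField R] T :=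
    Ideal.Quotient.mkₐ _ _
  let A' := A.map (residue R)
  let B' := B.map (residue R)
  have hAB' : A' * B' = 1 := by
    rw [← Matrix.map_mul, hAB, Matrix.map_one _ (map_zero _) (map_one _)]
  have hBA' : B' * A' = 1 := by
    rw [← Matrix.map_mul, hBA, Matrix.map_one _ (map_zero _) (map_one _)]
  let g := blockForm (residue R ∘ a) (residue R ∘ b) (residue R ∘ c) (residue R ∘ d)
  have hfg : f = subst B' (rename e g) := by rw [hf, map_subst, map_rename, map_blockForm]
  have hgf : rename e g = subst A' f := by rw [hfg, subst_subst, hBA', subst_one]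
  have hmk : ∀ q ∈ s, mk q = 0 := fun q hq =>
    Ideal.Quotient.eq_zero_iff_mem.mpr (Ideal.subset_span hq)
  let y : Fin I ⊕ Fin I ⊕ Fin J → T := fun v => mk (subst B' (X (e v)))
  have hy : ∀ q : MvPolynomial (Fin I ⊕ Fin I ⊕ Fin J) (ResidueField R),
      mk (subst B' (rename e q)) = aeval y q := by
    intro q
    have : (mk.comp (subst B')).comp (rename e) = aeval y := by
      apply algHom_ext
      intro v
      simp [y]
    exact congrArg (fun φ => φ q) this
  have hg0 : aeval y g = 0 := by
    rw [← hy, ← hfg]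
    exact hmk _ (Set.mem_insert _ _)
  have hpg : ∀ v, aeval y (pderiv v g) = 0 := by
    intro v
    -- By the chain rule the partials of the block form are linear combinations of the transformed
    -- partials of f, so they vanish in `T`.
    rw [← hy, ← pderiv_rename e.injective, hgf, pderiv_subst, map_sum, map_sum]
    refine Finset.sum_eq_zero fun j _ => ?_
    rw [map_mul, subst_C, subst_subst, hAB', subst_one, map_mul,
      hmk _ (Set.mem_insert_of_mem _ ⟨j, rfl⟩), mul_zero]
  have hgen : Algebra.adjoin (ResidueField R) (Set.range y) = ⊤ := by
    rw [Algebra.adjoin_range_eq_range_aeval, eq_top_iff]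
    intro t _
    obtain ⟨p, rfl⟩ := Ideal.Quotient.mk_surjective t
    refine ⟨rename e.symm (subst A' p), ?_⟩
    change aeval y _ = mk p
    rw [← hy, rename_rename, e.self_comp_symm, rename_id_apply, subst_subst, hAB', subst_one]
  have hblock : ∀ i, ∃ p q : Bool, (p.toNat + q.toNat : ℕ) ≤ addVal R (4 * a i * c i - b i ^ 2) ∧
      ∀ C₀ : Subalgebra (ResidueField R) T, (p → y (.inl i) ∈ C₀) → (q → y (.inr (.inl i)) ∈ C₀) →
        y (.inl i) ∈ C₀ ∧ y (.inr (.inl i)) ∈ C₀ := by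
    intro i
    refine exists_block_parameters _ _ _ ?_ ?_
    · have := hpg (.inl i)
      rw [pderiv_blockForm_x] at this
      simpa [Algebra.smul_def, map_ofNat] using this
    · have := hpg (.inr (.inl i))
      rw [pderiv_blockForm_y] at this
      simpa [Algebra.smul_def, map_ofNat] using this
  choose p q hpq hmem using hblock
  let r : Fin J → Bool := fun j => !decide (IsUnit (d j))
  let V : Finset (Fin I ⊕ Fin I ⊕ Fin J) :=
    Finset.univ.filter fun v => Sum.elim p (Sum.elim q r) v = true
  have hV : ∀ {v}, Sum.elim p (Sum.elim q r) v = true → v ∈ V := fun h => by simpa [V] using h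
  have hcard : (V.card : ℕ∞) ≤ addVal R (∏ k, blockDisc a b c d k) := by
    have h1 : V.card = ∑ i, ((p i).toNat + (q i).toNat) + ∑ j, (r j).toNat := by
      have htoNat : ∀ t : Bool, (if t = true then 1 else 0) = t.toNat := by decide
      simp only [V, Finset.card_filter, htoNat, Fintype.sum_sum_type, Sum.elim_inl, Sum.elim_inr,
        Finset.sum_add_distrib, add_assoc]
    rw [addVal_prod, Fintype.sum_sum_type, h1, Nat.cast_add, Nat.cast_sum, Nat.cast_sum]
    refine add_le_add (Finset.sum_le_sum fun i _ => hpq i) (Finset.sum_le_sum fun j _ => ?_)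
    by_cases hd : IsUnit (d j)
    · simp [r, hd]
    · simpa [r, hd, blockDisc] using one_le_addVal hd
  refine (ringKrullDim_le_card V y hgen fun C₀ hpow hVC => ?_).trans (by exact_mod_cast hcard)
  have hxy : ∀ i, y (.inl i) ∈ C₀ ∧ y (.inr (.inl i)) ∈ C₀ := fun i =>
    hmem i C₀ (fun h => hVC _ (hV h)) (fun h => hVC _ (hV h))
  have hz : ∀ j, y (.inr (.inr j)) ∈ C₀ := by
    intro j
    by_cases hd : IsUnit (d j)
    -- In residue characteristic 2 the partial derivative 2dz gives no information on z. As z is the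
    -- only such variable, the equation f = 0 expresses z² through the other coordinates.
    · refine hpow _ 2 two_pos ?_
      have : Subsingleton (Fin J) := Fin.subsingleton_iff_le_one.mpr hJ
      have hd0 : residue R (d j) ≠ 0 := (residue_ne_zero_iff_isUnit _).mpr hd
      let α := algebraMap (ResidueField R) T
      have hα : ∀ u, α u ∈ C₀ := C₀.algebraMap_mem
      let t : T := ∑ i, (α (residue R (a i)) * y (.inl i) ^ 2 +
        α (residue R (b i)) * (y (.inl i) * y (.inr (.inl i))) +
        α (residue R (c i)) * y (.inr (.inl i)) ^ 2)
      have ht : t ∈ C₀ := C₀.sum_mem fun i _ => C₀.add_mem (C₀.add_mem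
        (C₀.mul_mem (hα _) (C₀.pow_mem (hxy i).1 2))
        (C₀.mul_mem (hα _) (C₀.mul_mem (hxy i).1 (hxy i).2)))
        (C₀.mul_mem (hα _) (C₀.pow_mem (hxy i).2 2))
      have h0 : t + α (residue R (d j)) * y (.inr (.inr j)) ^ 2 = 0 := by
        rw [← hg0]
        simp [g, t, α, blockForm, mul_assoc, Fintype.sum_subsingleton _ j]
      have h1 : α (residue R (d j))⁻¹ * α (residue R (d j)) = 1 := by
        rw [← map_mul, inv_mul_cancel₀ hd0, map_one]
      have : y (.inr (.inr j)) ^ 2 = α (residue R (d j))⁻¹ * -t := by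
        linear_combination α (residue R (d j))⁻¹ * h0 - y (.inr (.inr j)) ^ 2 * h1
      rw [this]
      exact C₀.mul_mem (hα _) (C₀.neg_mem ht)
    · exact hVC _ (hV (by simp [r, hd]))
  rintro (i | i | j)
  · exact (hxy i).1
  · exact (hxy i).2
  · exact hz j

/-- The valuation of the discriminant of a quadratic form over a discrete valuation ring. -/
theorem addVal_discriminant {Δ : CoeffRing n 2} (hΔ : IsDiscriminant n 2 Δ)
    {f : MvPolynomial (Fin (n + 1)) R} (hf : f.IsHomogeneous 2) :
    (IsSmoothHypersurface (map (residue R) f) → addVal R (evalAtForm Δ f) = 0) ∧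
    (¬ IsSmoothHypersurface (map (residue R) f) →
      topologicalKrullDim (singularLocus (map (residue R) f)) + 1 ≤
        ((addVal R (evalAtForm Δ f) : ℕ∞) : WithBot ℕ∞)) := by
  obtain ⟨I, J, hJ, hIJ, e, a, b, c, d, hequiv⟩ := exists_formEquiv_blockForm n hf
  obtain ⟨A, B, hAB, hBA, hA⟩ := formEquiv_iff.mp hequiv
  have hfB : f = subst B (rename e (blockForm a b c d)) := by
    rw [← hA, subst_subst, hAB, subst_one]
  have hideal : discriminantIdeal n = Ideal.span {Δ} := hΔ
  constructor
  · intro hs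
    rw [hfB] at hs
    -- Δ divides the half-determinant, whose value at f is a unit; hence so is Δ(f).
    obtain ⟨Q, hQ, hQdet⟩ := exists_half_det_mem hJ hIJ
    rw [hideal, Ideal.mem_span_singleton] at hQ
    have hdvd : evalAtForm Δ f ∣ evalAtForm Q f := map_dvd (aeval _) hQ
    rw [addVal_eq_zero_iff]
    refine isUnit_of_dvd_unit hdvd ?_
    rw [hfB, evalAtForm_half_det a b c d B e hQdet]
    refine IsUnit.mul (IsUnit.pow _ ?_) ?_
    · rw [← Matrix.isUnit_iff_isUnit_det]
      exact ⟨⟨B, A, hBA, hAB⟩, rfl⟩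
    · rw [IsUnit.prod_univ_iff]
      exact fun k => isUnit_blockDisc_of_isSmoothHypersurface hBA hs k
  · intro hs
    refine (topologicalKrullDim_zeroLocus_add_one_le _
      (Set.nonempty_iff_ne_empty.mpr hs)).trans ?_
    refine (ringKrullDim_singular_le hJ a b c d e hAB hBA (congrArg _ hfB)).trans ?_
    -- Now the opposite divisibility: the product of the block discriminants divides Δ(f).
    have hmem : Δ ∈ discriminantIdeal n := hideal ▸ Ideal.mem_span_singleton_self Δ
    have := addVal_le_iff_dvd.mpr (prod_blockDisc_dvd a b c d B e hmem)
    rw [← hfB] at this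
    exact WithBot.coe_le_coe.mpr this

end SingularDimension

end

end QuadricDisc

/-! ### The proposition -/

theorem proposition3p3 {R : Type*} [CommRing R] [IsDomain R] [IsDiscreteValuationRing R] :
    -- symmetric bilinear spaces
    (∀ (M : Type*) [AddCommGroup M] [Module R M] [Module.Free R M] [Module.Finite R M]
      (β : LinearMap.BilinForm R M), β.IsSymm →
        QuadricDisc.IsOrthogonalSumOfRankOneOrTwo β) ∧
    -- normal form of quadratic forms
    (∀ (n : ℕ) (f : MvPolynomial (Fin (n + 1)) R), f.IsHomogeneous 2 →
      ∃ I J : ℕ, 2 * I + J = n + 1 ∧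
        ∃ (e : Fin I ⊕ Fin I ⊕ Fin J ≃ Fin (n + 1)) (a b c : Fin I → R) (d : Fin J → R),
          QuadricDisc.FormEquiv f
            (MvPolynomial.rename e (QuadricDisc.blockForm a b c d))) ∧
    -- valuation of the discriminant
    (∀ n : ℕ, 1 ≤ n →
      (∃ Δ : QuadricDisc.CoeffRing n 2, QuadricDisc.IsDiscriminant n 2 Δ) ∧
      ∀ Δ : QuadricDisc.CoeffRing n 2, QuadricDisc.IsDiscriminant n 2 Δ →
        ∀ f : MvPolynomial (Fin (n + 1)) R, f.IsHomogeneous 2 →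
          (QuadricDisc.IsSmoothHypersurface (MvPolynomial.map (IsLocalRing.residue R) f) →
            IsDiscreteValuationRing.addVal R (QuadricDisc.evalAtForm Δ f) = 0) ∧
          (¬ QuadricDisc.IsSmoothHypersurface (MvPolynomial.map (IsLocalRing.residue R) f) →
            topologicalKrullDim
                (QuadricDisc.singularLocus (MvPolynomial.map (IsLocalRing.residue R) f)) + 1
              ≤ ((IsDiscreteValuationRing.addVal R (QuadricDisc.evalAtForm Δ f) : ℕ∞) :
                  WithBot ℕ∞))) := by
  refine ⟨fun M _ _ _ _ β hβ => ?_, fun n f hf => ?_, fun n _ =>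
    ⟨QuadricDisc.exists_isDiscriminant n, fun Δ hΔ f hf =>
      QuadricDisc.addVal_discriminant hΔ hf⟩⟩
  · obtain ⟨I, J, -, b, hb⟩ := QuadricDisc.exists_isBlockBasis hβ
    exact hb.isOrthogonalSum
  · obtain ⟨I, J, -, h⟩ := QuadricDisc.exists_formEquiv_blockForm n hf
    exact ⟨I, J, h⟩
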